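/- Let $n,k$ be integers with $1\le k\le n-3$. Let $C_n\subset\mathbb{P}^n$ be the complex rational normal curve $(s:t)\mapsto(s^n:s^{n-1}t:\dots:t^n)$, let $L\cong\mathbb{P}^{k-1}\subset\mathbb{P}^n$ be spanned by $k$ independent points $(a^i_0:\dots:a^i_n)$, $i=1,\dots,k$, and let $\pi_L:\mathbb{P}^n\dashrightarrow\mathbb{P}^{n-k}$ be the linear projection with centre $L$. Assume that $\mathbb{P}^1\cong C_n\to\mathbb{P}^{n-k}$ is everywhere defined with nowhere vanishing differential (this holds in particular if $\pi_L(C_n)$ has only ordinary singularities). Let $N=N_{\pi_L(C_n);\mathbb{P}^{n-k}}$ be the normal bundle of this map, i.e. the cokernel on $\mathbb{P}^1$ of the Jacobian matrix $\mathcal{O}(1)^2\to\mathcal{O}(n)^{n-k+1}$ of its coordinate forms. Let $N^L_{n,k}$ be the $3k\times(n-1)$ matrix with the rows $(a^i_j)_j$, $(-2a^i_{j+1})_j$, $(a^i_{j+2})_j$, where $0\le j\le n-2$, for $i=1,\dots,k$ (the map $\mathbb{C}^{n-1}\to\mathbb{C}^k\otimes H^0(\mathcal{O}(2))$ given by the forms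 $a^i_jt^2-2a^i_{j+1}ts+a^i_{j+2}s^2$), and let $\rho=\operatorname{rank}N^L_{n,k}$. (a) We have $k\le\rho\le n-1$ and $$N\cong\mathcal{O}(n+2)^{n-1-\rho}\oplus\mathcal{F},\qquad \mathcal{F}\cong\bigoplus_{i=1}^{\rho-k}\mathcal{O}(l_i),\quad l_i\ge n+3,\qquad \deg\mathcal{F}^\vee(n+2)=\sum_{i=1}^{\rho-k}(n+2-l_i)=-2k.$$ (b) For every integer $r$ with $1\le r\le n-k-2$: one has $2(n-k-r)-2k\ge0$ and $$N\cong\mathcal{O}(n+2)^{r-1}\oplus\mathcal{O}(n+3)^{2(n-k-r)-2k}\oplus\mathcal{F}',$$ where $\mathcal{F}'$ is a direct sum of line bundles $\mathcal{O}(l)$ with $l\ge n+3$, has rank $n-r-2(n-k-r)+k$ and satisfies $\deg\mathcal{F}'^\vee(n+2)=-2k+(2(n-k-r)-2k)$, if and only if $\rho=n-r$ and $2(n-k-r)\ge2k$. (c) $N\cong\mathcal{O}(n+2)^{n-k-2}\oplus\mathcal{O}(n+2+2k)$ if and only if $\rho=k+1$. -/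

import Mathlib

open scoped Polynomial LaurentPolynomial

noncomputable section

namespace P1

/-- The inclusion `ℂ[w] → ℂ[T;T⁻¹]`, `w ↦ T⁻¹`. Together with `Polynomial.toLaurent`
(`z ↦ T`) it glues the two affine lines to the projective line. -/
def toLaurentInv : ℂ[X] →+* ℂ[T;T⁻¹] :=
  ((LaurentPolynomial.invert : ℂ[T;T⁻¹] ≃ₐ[ℂ] ℂ[T;T⁻¹]) : ℂ[T;T⁻¹] →+* ℂ[T;T⁻¹]).comp
    Polynomial.toLaurent

/-- A quasi-coherent sheaf on the complex projective line with homogeneous coordinates `s, t`,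
given on the standard affine cover: its sections over `{s ≠ 0} = Spec ℂ[z]`, `z = t/s`
(a `ℂ[z]`-module), over `{t ≠ 0} = Spec ℂ[w]`, `w = s/t` (a `ℂ[w]`-module), and over the
intersection `Spec ℂ[T;T⁻¹]`, `T = z = w⁻¹`, with the restriction maps. The last
four fields say that the sections over the intersection are the localizations
`U₀[1/z]` and `U₁[1/w]`. -/
structure QCoh : Type 1 where
  U₀ : Type
  U₁ : Type
  U₀₁ : Type
  [grp₀ : AddCommGroup U₀]
  [grp₁ : AddCommGroup U₁]
  [grp₀₁ : AddCommGroup U₀₁]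
  [mod₀ : Module ℂ[X] U₀]
  [mod₁ : Module ℂ[X] U₁]
  [mod₀₁ : Module ℂ[T;T⁻¹] U₀₁]
  res₀ : U₀ →ₛₗ[(Polynomial.toLaurent : ℂ[X] →+* ℂ[T;T⁻¹])] U₀₁
  res₁ : U₁ →ₛₗ[toLaurentInv] U₀₁
  surj₀ : ∀ x : U₀₁, ∃ (j : ℕ) (u : U₀), res₀ u = (LaurentPolynomial.T (j : ℤ) : ℂ[T;T⁻¹]) • x
  surj₁ : ∀ x : U₀₁, ∃ (j : ℕ) (u : U₁), res₁ u = (LaurentPolynomial.T (-(j : ℤ)) : ℂ[T;T⁻¹]) • x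
  ker₀ : ∀ u : U₀, res₀ u = 0 → ∃ j : ℕ, (Polynomial.X ^ j : ℂ[X]) • u = 0
  ker₁ : ∀ u : U₁, res₁ u = 0 → ∃ j : ℕ, (Polynomial.X ^ j : ℂ[X]) • u = 0

attribute [instance] QCoh.grp₀ QCoh.grp₁ QCoh.grp₀₁ QCoh.mod₀ QCoh.mod₁ QCoh.mod₀₁

namespace QCoh

/-- A morphism of quasi-coherent sheaves on the projective line. -/
structure Hom (M N : QCoh) where
  f₀ : M.U₀ →ₗ[ℂ[X]] N.U₀
  f₁ : M.U₁ →ₗ[ℂ[X]] N.U₁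
  f₀₁ : M.U₀₁ →ₗ[ℂ[T;T⁻¹]] N.U₀₁
  comm₀ : ∀ u, f₀₁ (M.res₀ u) = N.res₀ (f₀ u)
  comm₁ : ∀ u, f₀₁ (M.res₁ u) = N.res₁ (f₁ u)

/-- An isomorphism of quasi-coherent sheaves on the projective line. -/
structure Iso (M N : QCoh) where
  e₀ : M.U₀ ≃ₗ[ℂ[X]] N.U₀
  e₁ : M.U₁ ≃ₗ[ℂ[X]] N.U₁
  e₀₁ : M.U₀₁ ≃ₗ[ℂ[T;T⁻¹]] N.U₀₁
  comm₀ : ∀ u, e₀₁ (M.res₀ u) = N.res₀ (e₀ u)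
  comm₁ : ∀ u, e₀₁ (M.res₁ u) = N.res₁ (e₁ u)

/-- `M` and `N` are isomorphic sheaves. -/
def Isomorphic (M N : QCoh) : Prop := Nonempty (Iso M N)

theorem toLaurent_X_pow (j : ℕ) :
    (Polynomial.toLaurent (Polynomial.X ^ j : ℂ[X]) : ℂ[T;T⁻¹]) = LaurentPolynomial.T (j : ℤ) :=
  Polynomial.toLaurent_X_pow j

theorem toLaurentInv_X_pow (j : ℕ) :
    toLaurentInv (Polynomial.X ^ j : ℂ[X]) = LaurentPolynomial.T (-(j : ℤ)) := by
  simp [toLaurentInv]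

/-- The cokernel sheaf of a morphism. -/
def coker {M N : QCoh} (φ : Hom M N) : QCoh where
  U₀ := N.U₀ ⧸ LinearMap.range φ.f₀
  U₁ := N.U₁ ⧸ LinearMap.range φ.f₁
  U₀₁ := N.U₀₁ ⧸ LinearMap.range φ.f₀₁
  res₀ := Submodule.mapQ _ _ N.res₀ (by
    rintro _ ⟨u, rfl⟩
    exact ⟨M.res₀ u, φ.comm₀ u⟩)
  res₁ := Submodule.mapQ _ _ N.res₁ (by
    rintro _ ⟨u, rfl⟩
    exact ⟨M.res₁ u, φ.comm₁ u⟩)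
  surj₀ := by
    intro x
    obtain ⟨x, rfl⟩ := Submodule.Quotient.mk_surjective _ x
    obtain ⟨j, u, h⟩ := N.surj₀ x
    exact ⟨j, Submodule.Quotient.mk u, by
      rw [Submodule.mapQ_apply, h, Submodule.Quotient.mk_smul]⟩
  surj₁ := by
    intro x
    obtain ⟨x, rfl⟩ := Submodule.Quotient.mk_surjective _ x
    obtain ⟨j, u, h⟩ := N.surj₁ x
    exact ⟨j, Submodule.Quotient.mk u, by
      rw [Submodule.mapQ_apply, h, Submodule.Quotient.mk_smul]⟩
  ker₀ := by
    intro u hu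
    obtain ⟨u, rfl⟩ := Submodule.Quotient.mk_surjective _ u
    rw [Submodule.mapQ_apply, Submodule.Quotient.mk_eq_zero] at hu
    obtain ⟨x, hx⟩ := hu
    obtain ⟨j, v, hv⟩ := M.surj₀ x
    have h1 : N.res₀ ((Polynomial.X ^ j : ℂ[X]) • u - φ.f₀ v) = 0 := by
      rw [map_sub, map_smulₛₗ, ← φ.comm₀, hv, map_smul, hx, toLaurent_X_pow, sub_self]
    obtain ⟨i, hi⟩ := N.ker₀ _ h1
    refine ⟨i + j, ?_⟩
    rw [← Submodule.Quotient.mk_smul, Submodule.Quotient.mk_eq_zero]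
    refine ⟨(Polynomial.X ^ i : ℂ[X]) • v, ?_⟩
    rw [smul_sub, sub_eq_zero] at hi
    rw [map_smul, ← hi, smul_smul, pow_add]
  ker₁ := by
    intro u hu
    obtain ⟨u, rfl⟩ := Submodule.Quotient.mk_surjective _ u
    rw [Submodule.mapQ_apply, Submodule.Quotient.mk_eq_zero] at hu
    obtain ⟨x, hx⟩ := hu
    obtain ⟨j, v, hv⟩ := M.surj₁ x
    have h1 : N.res₁ ((Polynomial.X ^ j : ℂ[X]) • u - φ.f₁ v) = 0 := by
      rw [map_sub, map_smulₛₗ, ← φ.comm₁, hv, map_smul, hx, toLaurentInv_X_pow, sub_self]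
    obtain ⟨i, hi⟩ := N.ker₁ _ h1
    refine ⟨i + j, ?_⟩
    rw [← Submodule.Quotient.mk_smul, Submodule.Quotient.mk_eq_zero]
    refine ⟨(Polynomial.X ^ i : ℂ[X]) • v, ?_⟩
    rw [smul_sub, sub_eq_zero] at hi
    rw [map_smul, ← hi, smul_smul, pow_add]

/-- The direct sum of two quasi-coherent sheaves. -/
def dsum (M N : QCoh) : QCoh where
  U₀ := M.U₀ × N.U₀
  U₁ := M.U₁ × N.U₁
  U₀₁ := M.U₀₁ × N.U₀₁
  res₀ :=
    { toFun := fun u => (M.res₀ u.1, N.res₀ u.2)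
      map_add' := fun u v => by simp
      map_smul' := fun c u => by simp [map_smulₛₗ] }
  res₁ :=
    { toFun := fun u => (M.res₁ u.1, N.res₁ u.2)
      map_add' := fun u v => by simp
      map_smul' := fun c u => by simp [map_smulₛₗ] }
  surj₀ := by
    rintro ⟨x, y⟩
    obtain ⟨i, u, hu⟩ := M.surj₀ x
    obtain ⟨j, v, hv⟩ := N.surj₀ y
    refine ⟨i + j, ((Polynomial.X ^ j : ℂ[X]) • u, (Polynomial.X ^ i : ℂ[X]) • v), ?_⟩
    ext
    · simp only [LinearMap.coe_mk, AddHom.coe_mk, map_smulₛₗ, hu, toLaurent_X_pow, smul_smul,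
        ← LaurentPolynomial.T_add, Prod.smul_mk]
      congr 2; push_cast; ring
    · simp only [LinearMap.coe_mk, AddHom.coe_mk, map_smulₛₗ, hv, toLaurent_X_pow, smul_smul,
        ← LaurentPolynomial.T_add, Prod.smul_mk]
      congr 2
  surj₁ := by
    rintro ⟨x, y⟩
    obtain ⟨i, u, hu⟩ := M.surj₁ x
    obtain ⟨j, v, hv⟩ := N.surj₁ y
    refine ⟨i + j, ((Polynomial.X ^ j : ℂ[X]) • u, (Polynomial.X ^ i : ℂ[X]) • v), ?_⟩
    ext
    · simp only [LinearMap.coe_mk, AddHom.coe_mk, map_smulₛₗ, hu, toLaurentInv_X_pow, smul_smul,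
        ← LaurentPolynomial.T_add, Prod.smul_mk]
      congr 2; push_cast; ring
    · simp only [LinearMap.coe_mk, AddHom.coe_mk, map_smulₛₗ, hv, toLaurentInv_X_pow, smul_smul,
        ← LaurentPolynomial.T_add, Prod.smul_mk]
      congr 2; push_cast; ring
  ker₀ := by
    rintro ⟨u, v⟩ h
    obtain ⟨h1, h2⟩ := Prod.mk.inj h
    obtain ⟨i, hi⟩ := M.ker₀ u h1
    obtain ⟨j, hj⟩ := N.ker₀ v h2
    refine ⟨i + j, ?_⟩
    ext
    · simp [pow_add, mul_smul, smul_comm _ _ u, hi]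
    · simp [pow_add, mul_smul, hj]
  ker₁ := by
    rintro ⟨u, v⟩ h
    obtain ⟨h1, h2⟩ := Prod.mk.inj h
    obtain ⟨i, hi⟩ := M.ker₁ u h1
    obtain ⟨j, hj⟩ := N.ker₁ v h2
    refine ⟨i + j, ?_⟩
    ext
    · simp [pow_add, mul_smul, smul_comm _ _ u, hi]
    · simp [pow_add, mul_smul, hj]

theorem exists_clear {ι : Type} [Finite ι] (x : ι → ℂ[T;T⁻¹]) :
    ∃ (j : ℕ) (u : ι → ℂ[X]), ∀ i, Polynomial.toLaurent (u i) =
      (LaurentPolynomial.T (j : ℤ) : ℂ[T;T⁻¹]) * x i := by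
  have := Fintype.ofFinite ι
  choose n f h using fun i => LaurentPolynomial.exists_T_pow (x i)
  refine ⟨∑ i, n i, fun i => Polynomial.X ^ (∑ i, n i - n i) * f i, fun i => ?_⟩
  have hle : n i ≤ ∑ i, n i := Finset.single_le_sum (fun _ _ => Nat.zero_le _) (Finset.mem_univ i)
  rw [map_mul, toLaurent_X_pow, h, mul_left_comm, ← LaurentPolynomial.T_add, mul_comm]
  congr 2
  push_cast [hle]
  ring

/-- The direct sum `⊕ᵢ O(d i)` of line bundles. A section of `O(d)` is trivialized by `s ^ d`
on `{s ≠ 0}` and on the intersection, and by `t ^ d` on `{t ≠ 0}`; as `t ^ d = T ^ d s ^ d`,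
the second restriction map is `h(w) ↦ T ^ d h(T⁻¹)`. -/
def lineSum {ι : Type} [Finite ι] (d : ι → ℤ) : QCoh where
  U₀ := ι → ℂ[X]
  U₁ := ι → ℂ[X]
  U₀₁ := ι → ℂ[T;T⁻¹]
  res₀ :=
    { toFun := fun u i => Polynomial.toLaurent (u i)
      map_add' := fun u v => by ext1 i; simp
      map_smul' := fun c u => by ext1 i; simp }
  res₁ :=
    { toFun := fun u i => LaurentPolynomial.T (d i) * toLaurentInv (u i)
      map_add' := fun u v => by ext1 i; simp [mul_add]
      map_smul' := fun c u => by
        ext1 i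
        rw [Pi.smul_apply, smul_eq_mul, map_mul, Pi.smul_apply, smul_eq_mul, mul_left_comm] }
  surj₀ := by
    intro x
    obtain ⟨j, u, h⟩ := exists_clear x
    exact ⟨j, u, funext h⟩
  surj₁ := by
    intro x
    obtain ⟨j, u, h⟩ := exists_clear
      (fun i => LaurentPolynomial.invert (LaurentPolynomial.T (-d i) * x i))
    refine ⟨j, u, funext fun i => ?_⟩
    change LaurentPolynomial.T (d i) * LaurentPolynomial.invert (Polynomial.toLaurent (u i)) =
      LaurentPolynomial.T (-(j : ℤ)) * x i
    have hinv : ∀ y : ℂ[T;T⁻¹], LaurentPolynomial.invert (LaurentPolynomial.invert y) = y :=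
      LaurentPolynomial.involutive_invert
    rw [h i, map_mul, LaurentPolynomial.invert_T, hinv, mul_left_comm,
      ← mul_assoc (LaurentPolynomial.T (d i)), ← LaurentPolynomial.T_add, add_neg_cancel,
      LaurentPolynomial.T_zero, one_mul]
  ker₀ := by
    intro u h
    refine ⟨0, ?_⟩
    rw [pow_zero, one_smul]
    funext i
    exact Polynomial.toLaurent_injective (by simpa using congrFun h i)
  ker₁ := by
    intro u h
    refine ⟨0, ?_⟩
    rw [pow_zero, one_smul]
    funext i
    have h1 : LaurentPolynomial.T (d i) * toLaurentInv (u i) = 0 := congrFun h i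
    have h2 : toLaurentInv (u i) = 0 := by
      have := congrArg (fun y => LaurentPolynomial.T (-d i) * y) h1
      simpa [← mul_assoc, ← LaurentPolynomial.T_add] using this
    refine Polynomial.toLaurent_injective (LaurentPolynomial.invert.injective ?_)
    simpa [toLaurentInv] using h2

/-- `O(d)^p`. -/
def O (d : ℤ) (p : ℕ) : QCoh := lineSum (fun _ : Fin p => d)

theorem chart_compat (g : MvPolynomial (Fin 2) ℂ) :
    (MvPolynomial.aeval ![1, LaurentPolynomial.T 1] g : ℂ[T;T⁻¹]) =
      Polynomial.toLaurent (MvPolynomial.aeval ![1, Polynomial.X] g : ℂ[X]) := by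
  induction g using MvPolynomial.induction_on with
  | C c => simp [LaurentPolynomial.algebraMap_apply]
  | add p q hp hq => simp only [map_add, hp, hq]
  | mul_X p i hp =>
    rw [map_mul, map_mul, map_mul, hp]
    fin_cases i <;> simp

theorem chart_compat_inv {g : MvPolynomial (Fin 2) ℂ} {e : ℕ} (hg : g.IsHomogeneous e) :
    (MvPolynomial.aeval ![1, LaurentPolynomial.T 1] g : ℂ[T;T⁻¹]) =
      LaurentPolynomial.T (e : ℤ) *
        toLaurentInv (MvPolynomial.aeval ![Polynomial.X, 1] g : ℂ[X]) := by
  rw [MvPolynomial.aeval_def, MvPolynomial.eval₂_eq', MvPolynomial.aeval_def,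
    MvPolynomial.eval₂_eq', map_sum, Finset.mul_sum]
  refine Finset.sum_congr rfl fun m hm => ?_
  have hdeg : m 0 + m 1 = e := by
    have := hg (MvPolynomial.mem_support_iff.mp hm)
    rw [Finsupp.weight_apply, Finsupp.sum_fintype _ _ (by simp)] at this
    simpa using this
  have hC : ∀ c : ℂ, toLaurentInv (algebraMap ℂ ℂ[X] c) = algebraMap ℂ ℂ[T;T⁻¹] c := fun c => by
    simp [toLaurentInv, LaurentPolynomial.algebraMap_apply]
  have hp : ∀ c : ℕ, (LaurentPolynomial.T 1 : ℂ[T;T⁻¹]) ^ c = LaurentPolynomial.T (c : ℤ) :=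
    fun c => by rw [LaurentPolynomial.T_pow, mul_one]
  simp only [Fin.prod_univ_two, Matrix.cons_val_zero, Matrix.cons_val_one, one_pow, one_mul,
    mul_one, map_mul, hC, hp, toLaurentInv_X_pow]
  rw [mul_left_comm, ← LaurentPolynomial.T_add]
  congr 2
  rw [← hdeg]; push_cast; ring

/-- The morphism `⊕ᵢ O(a i) → ⊕ⱼ O(b j)` whose matrix entry `O(a i) → O(b j)` is
multiplication by the form `g j i`, homogeneous in `s = X 0`, `t = X 1` of degree
`b j - a i` (or zero). On `{s ≠ 0}` the form becomes `g(1,z)`, on `{t ≠ 0}` it becomes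
`g(w,1)`. -/
def formHom {ι κ : Type} [Fintype ι] [Finite κ] (a : ι → ℤ) (b : κ → ℤ)
    (g : κ → ι → MvPolynomial (Fin 2) ℂ)
    (hg : ∀ j i, g j i = 0 ∨ ∃ e : ℕ, (g j i).IsHomogeneous e ∧ a i + e = b j) :
    Hom (lineSum a) (lineSum b) where
  f₀ := Matrix.mulVecLin
    (Matrix.of fun j i => (MvPolynomial.aeval ![1, Polynomial.X] (g j i) : ℂ[X]))
  f₁ := Matrix.mulVecLin
    (Matrix.of fun j i => (MvPolynomial.aeval ![Polynomial.X, 1] (g j i) : ℂ[X]))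
  f₀₁ := Matrix.mulVecLin
    (Matrix.of fun j i => (MvPolynomial.aeval ![1, LaurentPolynomial.T 1] (g j i) : ℂ[T;T⁻¹]))
  comm₀ := by
    intro u
    funext j
    change ∑ i, (MvPolynomial.aeval ![1, LaurentPolynomial.T 1] (g j i) : ℂ[T;T⁻¹]) *
        Polynomial.toLaurent (u i) =
      Polynomial.toLaurent (∑ i, (MvPolynomial.aeval ![1, Polynomial.X] (g j i) : ℂ[X]) * u i)
    simp only [map_sum, map_mul, chart_compat]
  comm₁ := by
    intro u
    funext j
    change ∑ i, (MvPolynomial.aeval ![1, LaurentPolynomial.T 1] (g j i) : ℂ[T;T⁻¹]) *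
        (LaurentPolynomial.T (a i) * toLaurentInv (u i)) =
      LaurentPolynomial.T (b j) *
        toLaurentInv (∑ i, (MvPolynomial.aeval ![Polynomial.X, 1] (g j i) : ℂ[X]) * u i)
    rw [map_sum, Finset.mul_sum]
    refine Finset.sum_congr rfl fun i _ => ?_
    rcases hg j i with h | ⟨e, h, he⟩
    · simp [h]
    · rw [chart_compat_inv h, ← he, add_comm (a i), LaurentPolynomial.T_add, map_mul]
      ring

end QCoh

/-- A parametrized rational curve of degree `n` in `ℙ^m`: the `m + 1` forms of degree `n` in
`s = X 0`, `t = X 1` that are the coordinates of the parametrization. -/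
structure RatCurve (n m : ℕ) where
  form : Fin (m + 1) → MvPolynomial (Fin 2) ℂ
  homog : ∀ j, (form j).IsHomogeneous n

namespace RatCurve

variable {n m : ℕ}

/-- The forms of the curve have no common zero and the morphism `ℙ¹ → ℙ^m` they define has
injective differential at every point: equivalently (Euler's formula), the Jacobian matrix of the
forms has rank `2` at every point of `ℙ¹`. -/
def IsImmersion (f : RatCurve n m) : Prop :=
  ∀ p : Fin 2 → ℂ, p ≠ 0 →
    LinearIndependent ℂ (fun (i : Fin 2) (j : Fin (m + 1)) =>
      MvPolynomial.eval p (MvPolynomial.pderiv i (f.form j)))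

theorem pderiv_deg (f : RatCurve n m) (j : Fin (m + 1)) (i : Fin 2) :
    MvPolynomial.pderiv i (f.form j) = 0 ∨
      ∃ e : ℕ, (MvPolynomial.pderiv i (f.form j)).IsHomogeneous e ∧ (1 : ℤ) + e = n := by
  rcases Nat.eq_zero_or_pos n with rfl | hn
  · left
    have h := MvPolynomial.totalDegree_eq_zero_iff_eq_C.mp
      (Nat.le_zero.mp (f.homog j).totalDegree_le)
    rw [h, MvPolynomial.pderiv_C]
  · exact Or.inr ⟨n - 1, (f.homog j).pderiv, by omega⟩

/-- The normal bundle of the curve, pulled back to `ℙ¹`: the cokernel of the Jacobian matrix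
`O(1)² → O(n)^(m+1)`. (By the Euler sequences of `ℙ¹` and `ℙ^m` it is the cokernel of
`Tℙ¹ → f^* Tℙ^m`.) -/
def normalBundle (f : RatCurve n m) : QCoh :=
  QCoh.coker (QCoh.formHom (fun _ : Fin 2 => (1 : ℤ)) (fun _ : Fin (m + 1) => (n : ℤ))
    (fun j i => MvPolynomial.pderiv i (f.form j)) f.pderiv_deg)

/-- The rational normal curve `C_n`, parametrized by `(sⁿ, sⁿ⁻¹t, …, tⁿ)`. -/
def normalCurve (n : ℕ) : RatCurve n n where
  form i := MvPolynomial.X 0 ^ (n - (i : ℕ)) * MvPolynomial.X 1 ^ (i : ℕ)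
  homog i := by
    have h := ((MvPolynomial.isHomogeneous_X ℂ (0 : Fin 2)).pow (n - (i : ℕ))).mul
      ((MvPolynomial.isHomogeneous_X ℂ (1 : Fin 2)).pow (i : ℕ))
    have e : 1 * (n - (i : ℕ)) + 1 * (i : ℕ) = n := by omega
    rwa [e] at h

/-- The image of a parametrized curve in `ℙ^l` under the linear projection induced by
`π : ℂ^(l+1) → ℂ^(m+1)`; the centre of the projection is the projectivization of `ker π`. -/
def proj {l : ℕ} (f : RatCurve n l) (π : (Fin (l + 1) → ℂ) →ₗ[ℂ] (Fin (m + 1) → ℂ)) :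
    RatCurve n m where
  form j := ∑ i, MvPolynomial.C (π (Pi.single i 1) j) * f.form i
  homog j := MvPolynomial.IsHomogeneous.sum _ _ _ fun i _ => by
    simpa using (MvPolynomial.isHomogeneous_C (Fin 2) (π (Pi.single i 1) j)).mul (f.homog i)

end RatCurve

/-- The numerical `3k × (n-1)` matrix `N^L_{n,k}` for `L` spanned by the points
`a i = (a i 0, …, a i n)`, `i = 1, …, k`: the matrix on global sections of the map
`O^(n-1) → ℂ^k ⊗ O(2)` with entries `a i j t² - 2 a i (j+1) t s + a i (j+2) s²`. The three rows
with first index `i` hold the coefficients of `t²`, `ts`, `s²`. -/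
def NMatrix {n k : ℕ} (a : Fin k → Fin (n + 1) → ℂ) : Matrix (Fin k × Fin 3) (Fin (n - 1)) ℂ :=
  Matrix.of fun r j =>
    ![a r.1 ⟨j, by omega⟩, -2 * a r.1 ⟨j + 1, by omega⟩, a r.1 ⟨j + 2, by omega⟩] r.2

end P1

end

/-! The dual of the normal bundle, twisted by `O(n)`, is the sheaf of syzygies of the partial
derivatives of the coordinate forms. On one chart these form the saturated module `RatCurve.syz`. A
basis of it with independent top coefficients (`exists_isMinimalBasis`) stays independent at every
point of the projective line, including infinity. If its degree bounds are `b i`, it is the matrix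
of a surjection onto the sum of the `O(n + b i)` with kernel the image of the Jacobian. So `N` is
that sum, and comparing determinants on the two charts gives `∑ b i = 2(n - 1)`
(`RatCurve.IsImmersion.normalBundle_isomorphic`).

Syzygies of the projected curve are the syzygies of `C_n` annihilated by the centre `L`. For `C_n`
there are none of degree at most one, and those of degree at most two are the constant combinations
of the vectors `X² eⱼ - 2X eⱼ₊₁ + eⱼ₊₂` (`eq_quadSyz`). Annihilation by the points of `L` is the
linear system with matrix `NMatrix a` (`mem_ker_NMatrix`). Hence every `b i ≥ 2`, and exactly `n - 1
- ρ` of them equal 2.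

The rest is counting. The remaining `ρ - k` degrees are at least `n + 3` and have prescribed sum,
which forces many of them to equal `n + 3`, or determines the degree if only one is left. The
converses hold because the number of summands of degree at most `c` is an isomorphism invariant
(`QCoh.Isomorphic.card_eq`). -/

namespace P1

/-! ### Gluing polynomials on the two charts -/

theorem toLaurent_eq_T_mul_toLaurentInv_reflect {p : ℂ[X]} {b : ℕ} (h : p.natDegree ≤ b) :
    (Polynomial.toLaurent p : ℂ[T;T⁻¹]) =
      LaurentPolynomial.T (b : ℤ) * toLaurentInv (p.reflect b) := by
  refine Polynomial.induction_with_natDegree_le (fun p : ℂ[X] =>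
    (Polynomial.toLaurent p : ℂ[T;T⁻¹]) = LaurentPolynomial.T (b : ℤ) *
      toLaurentInv (p.reflect b)) b (by simp) (fun i c _ hi => ?_) (fun f g _ _ hf hg => ?_) p h
  ·
    rw [Polynomial.reflect_C_mul_X_pow, Polynomial.revAt_le hi, map_mul, map_mul,
      QCoh.toLaurent_X_pow, QCoh.toLaurentInv_X_pow, mul_left_comm, ← LaurentPolynomial.T_add]
    have hC : toLaurentInv (Polynomial.C c) = LaurentPolynomial.C c := by simp [toLaurentInv]
    rw [hC, Polynomial.toLaurent_C]
    congr 2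
    push_cast [hi]
    ring
  · simp only [map_add, Polynomial.reflect_add, mul_add]
    rw [hf, hg]

theorem toLaurentInv_injective : Function.Injective toLaurentInv :=
  LaurentPolynomial.invert.injective.comp Polynomial.toLaurent_injective

/-- This is the vanishing of maps `O(i) → O(j)` for `j < i`: the left side has only exponents at
least `i`, the right side only exponents at most `j`. -/
theorem eq_zero_of_toLaurent_eq {f g : ℂ[X]} {i j : ℤ} (hij : j < i)
    (h : LaurentPolynomial.T i * Polynomial.toLaurent f =
      LaurentPolynomial.T j * toLaurentInv g) : f = 0 := by
  obtain ⟨m, hm⟩ : ∃ m : ℕ, i = j + m := ⟨(i - j).toNat, by omega⟩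
  set N := g.natDegree with hN
  have h1 := toLaurent_eq_T_mul_toLaurentInv_reflect
    (p := g.reflect N) (b := N) (Polynomial.natDegree_reflect_le.trans (by simp [hN]))
  rw [Polynomial.reflect_reflect] at h1
  have h2 : Polynomial.toLaurent (Polynomial.X ^ (m + N) * f) =
      Polynomial.toLaurent (g.reflect N) := by
    rw [h1, map_mul, QCoh.toLaurent_X_pow]
    have := congrArg (fun y => LaurentPolynomial.T (-j + N) * y) h
    simp only [← mul_assoc, ← LaurentPolynomial.T_add] at this
    convert this using 3
    · push_cast; omega
    · ring
  have h3 := Polynomial.toLaurent_injective h2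
  by_contra hf
  have h4 : (Polynomial.X ^ (m + N) * f).natDegree ≤ N := by
    rw [h3]; exact Polynomial.natDegree_reflect_le.trans (by simp [hN])
  rw [Polynomial.natDegree_X_pow_mul _ hf] at h4
  omega

/-! ### Isomorphisms of sheaves and uniqueness of the splitting type -/

namespace QCoh

theorem Isomorphic.symm {M N : QCoh} (h : Isomorphic M N) : Isomorphic N M := by
  obtain ⟨e⟩ := h
  refine ⟨⟨e.e₀.symm, e.e₁.symm, e.e₀₁.symm, fun u => ?_, fun u => ?_⟩⟩
  · rw [LinearEquiv.symm_apply_eq, e.comm₀, LinearEquiv.apply_symm_apply]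
  · rw [LinearEquiv.symm_apply_eq, e.comm₁, LinearEquiv.apply_symm_apply]

theorem Isomorphic.trans {M N Q : QCoh} (h : Isomorphic M N) (h' : Isomorphic N Q) :
    Isomorphic M Q := by
  obtain ⟨e⟩ := h
  obtain ⟨f⟩ := h'
  refine ⟨⟨e.e₀.trans f.e₀, e.e₁.trans f.e₁, e.e₀₁.trans f.e₀₁, fun u => ?_, fun u => ?_⟩⟩
  · simp only [LinearEquiv.trans_apply, e.comm₀, f.comm₀]
  · simp only [LinearEquiv.trans_apply, e.comm₁, f.comm₁]

theorem isomorphic_refl (M : QCoh) : Isomorphic M M :=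
  ⟨⟨LinearEquiv.refl _ _, LinearEquiv.refl _ _, LinearEquiv.refl _ _, fun _ => rfl, fun _ => rfl⟩⟩

theorem Isomorphic.dsum {M N M' N' : QCoh} (h : Isomorphic M M') (h' : Isomorphic N N') :
    Isomorphic (M.dsum N) (M'.dsum N') := by
  obtain ⟨e⟩ := h
  obtain ⟨f⟩ := h'
  refine ⟨⟨e.e₀.prodCongr f.e₀, e.e₁.prodCongr f.e₁, e.e₀₁.prodCongr f.e₀₁, ?_, ?_⟩⟩
  · rintro ⟨u, v⟩
    exact Prod.ext (e.comm₀ u) (f.comm₀ v)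
  · rintro ⟨u, v⟩
    exact Prod.ext (e.comm₁ u) (f.comm₁ v)

theorem isomorphic_lineSum_comp {ι κ : Type} [Finite ι] [Finite κ] (d : κ → ℤ) (e : ι ≃ κ) :
    Isomorphic (lineSum (d ∘ e)) (lineSum d) := by
  refine ⟨⟨LinearEquiv.funCongrLeft _ _ e.symm, LinearEquiv.funCongrLeft _ _ e.symm,
    LinearEquiv.funCongrLeft _ _ e.symm, fun u => ?_, fun u => ?_⟩⟩
  · rfl
  · funext j
    change LaurentPolynomial.T (d (e (e.symm j))) * _ = LaurentPolynomial.T (d j) * _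
    rw [Equiv.apply_symm_apply]
    rfl

theorem isomorphic_dsum_lineSum {ι κ : Type} [Finite ι] [Finite κ] (d : ι → ℤ) (d' : κ → ℤ) :
    Isomorphic ((lineSum d).dsum (lineSum d')) (lineSum (Sum.elim d d')) := by
  refine ⟨⟨(LinearEquiv.sumArrowLequivProdArrow ι κ ℂ[X] ℂ[X]).symm,
    (LinearEquiv.sumArrowLequivProdArrow ι κ ℂ[X] ℂ[X]).symm,
    (LinearEquiv.sumArrowLequivProdArrow ι κ ℂ[T;T⁻¹] ℂ[T;T⁻¹]).symm, ?_, ?_⟩⟩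
  · rintro ⟨u, v⟩
    funext i
    cases i <;> rfl
  · rintro ⟨u, v⟩
    funext i
    cases i <;> rfl

theorem isomorphic_coker {M N Q : QCoh} (φ : Hom M N) (ψ : Hom N Q)
    (s₀ : Function.Surjective ψ.f₀) (s₁ : Function.Surjective ψ.f₁)
    (s₀₁ : Function.Surjective ψ.f₀₁)
    (k₀ : LinearMap.range φ.f₀ = LinearMap.ker ψ.f₀)
    (k₁ : LinearMap.range φ.f₁ = LinearMap.ker ψ.f₁)
    (k₀₁ : LinearMap.range φ.f₀₁ = LinearMap.ker ψ.f₀₁) : Isomorphic (coker φ) Q := by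
  refine ⟨⟨(Submodule.quotEquivOfEq _ _ k₀).trans (ψ.f₀.quotKerEquivOfSurjective s₀),
    (Submodule.quotEquivOfEq _ _ k₁).trans (ψ.f₁.quotKerEquivOfSurjective s₁),
    (Submodule.quotEquivOfEq _ _ k₀₁).trans (ψ.f₀₁.quotKerEquivOfSurjective s₀₁), ?_, ?_⟩⟩
  · intro u
    obtain ⟨u, rfl⟩ := Submodule.Quotient.mk_surjective _ u
    exact ψ.comm₀ u
  · intro u
    obtain ⟨u, rfl⟩ := Submodule.Quotient.mk_surjective _ u
    exact ψ.comm₁ u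

theorem Iso.res_eq_smul_res {M N : QCoh} (e : Iso M N) {u : M.U₀} {v : M.U₁} {c : ℂ[T;T⁻¹]}
    (h : M.res₁ v = c • M.res₀ u) : N.res₁ (e.e₁ v) = c • N.res₀ (e.e₀ u) := by
  rw [← e.comm₀, ← e.comm₁, h, map_smul]

/-- The matrix entry from `O(d i)` to `O(d' j)` is a section of a line bundle of negative degree. -/
theorem Iso.apply_single_eq_zero {ι κ : Type} [Fintype ι] [DecidableEq ι] [Finite κ]
    {d : ι → ℤ} {d' : κ → ℤ} (e : Iso (lineSum d) (lineSum d')) {i : ι} {j : κ}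
    (h : d' j < d i) : (e.e₀ (Pi.single i (1 : ℂ[X]) : ι → ℂ[X]) : κ → ℂ[X]) j = 0 := by
  have h1 : (lineSum d).res₁ (Pi.single i (1 : ℂ[X]) : ι → ℂ[X]) =
      (LaurentPolynomial.T (d i) : ℂ[T;T⁻¹]) •
        (lineSum d).res₀ (Pi.single i (1 : ℂ[X]) : ι → ℂ[X]) := by
    funext i'
    change LaurentPolynomial.T (d i') * toLaurentInv ((Pi.single i (1 : ℂ[X]) : ι → ℂ[X]) i') =
      LaurentPolynomial.T (d i) *
        Polynomial.toLaurent ((Pi.single i (1 : ℂ[X]) : ι → ℂ[X]) i')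
    by_cases hi : i' = i
    · subst hi; simp
    · simp [Pi.single_eq_of_ne hi]
  exact eq_zero_of_toLaurent_eq h (congrFun (e.res_eq_smul_res h1) j).symm

/-- The matrix of an isomorphism on a chart is block triangular: rows of degree at most `c` vanish
in all columns of degree above `c`. So the block of rows and columns of degree at most `c` is still
surjective, which compares the ranks. -/
theorem Isomorphic.card_le {ι κ : Type} [Fintype ι] [Fintype κ] {d : ι → ℤ} {d' : κ → ℤ}
    (h : Isomorphic (lineSum d) (lineSum d')) (c : ℤ) :
    Fintype.card {j // d' j ≤ c} ≤ Fintype.card {i // d i ≤ c} := by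
  classical
  obtain ⟨e⟩ := h
  let E : (ι → ℂ[X]) ≃ₗ[ℂ[X]] (κ → ℂ[X]) := e.e₀
  let A : Matrix {j // d' j ≤ c} {i // d i ≤ c} ℂ[X] :=
    Matrix.of fun j i => E (Pi.single i.1 1) j.1
  refine card_le_of_surjective ℂ[X] A.mulVecLin fun y => ?_
  obtain ⟨x, hx⟩ := E.surjective fun j => if hj : d' j ≤ c then y ⟨j, hj⟩ else 0
  refine ⟨fun i => x i.1, ?_⟩
  funext j
  have h1 : E x j.1 = y j := by rw [hx]; simp [j.2]
  rw [← h1]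
  change ∑ i : {i // d i ≤ c}, E (Pi.single i.1 1) j.1 * x i.1 = _
  have h3 (i : ι) : (fun a => if i = a then (1 : ℂ[X]) else 0) = Pi.single i 1 := by
    funext a
    simp [Pi.single_apply, eq_comm]
  have h2 := congrFun (LinearMap.pi_apply_eq_sum_univ E.toLinearMap x) j.1
  rw [LinearEquiv.coe_coe] at h2
  rw [h2, Finset.sum_apply,
    ← Finset.sum_subset (Finset.subset_univ (Finset.univ.filter fun i => d i ≤ c))]
  · rw [Finset.sum_subtype (p := fun i => d i ≤ c) _ (by simp)]
    refine Finset.sum_congr rfl fun i _ => ?_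
    simp only [Pi.smul_apply, smul_eq_mul, mul_comm (x i.1)]
    rw [h3 i.1]
  · intro i _ hi
    have : E (Pi.single i 1) j.1 = 0 :=
      e.apply_single_eq_zero (lt_of_le_of_lt j.2 (by simpa using hi))
    simp only [Pi.smul_apply, smul_eq_mul, h3 i, this, mul_zero]

theorem Isomorphic.card_eq {ι κ : Type} [Fintype ι] [Fintype κ] {d : ι → ℤ} {d' : κ → ℤ}
    (h : Isomorphic (lineSum d) (lineSum d')) (c : ℤ) :
    Fintype.card {i // d i ≤ c} = Fintype.card {j // d' j ≤ c} :=
  le_antisymm (h.symm.card_le c) (h.card_le c)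

end QCoh

/-! ### Polynomial matrices: right inverses and split exactness -/

open Polynomial in
theorem exists_X_sub_C_mem_of_isMaximal {I : Ideal ℂ[X]} (hI : I.IsMaximal) :
    ∃ c : ℂ, (X - C c : ℂ[X]) ∈ I := by
  obtain ⟨g, rfl⟩ := (inferInstance : I.IsPrincipal)
  have hg0 : g ≠ 0 := by
    rintro rfl
    exact Polynomial.not_isField ℂ (by
      have := Ring.ne_bot_of_isMaximal_of_not_isField hI (Polynomial.not_isField ℂ)
      simp at this)
  have hp : Prime g := (Ideal.span_singleton_prime hg0).mp hI.isPrime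
  have hd : g.degree ≠ 0 := fun h => hp.not_isUnit (isUnit_iff_degree_eq_zero.mpr h)
  obtain ⟨c, hc⟩ := IsAlgClosed.exists_root g hd
  refine ⟨c, Ideal.mem_span_singleton.mpr ?_⟩
  exact ((irreducible_X_sub_C c).associated_of_dvd hp.irreducible (dvd_iff_isRoot.mpr hc)).symm.dvd

theorem mulVec_surjective_of_linearIndependent_row {K m n : Type*} [Field K] [Fintype m]
    [Fintype n] [DecidableEq m] [DecidableEq n] (A : Matrix m n K) (h : LinearIndependent K A.row) :
    Function.Surjective A.mulVec := by
  have h1 : Module.finrank K (LinearMap.range A.mulVecLin) = Module.finrank K (m → K) := by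
    rw [Module.finrank_fintype_fun_eq_card]
    exact h.rank_matrix
  have h2 := Submodule.eq_top_of_finrank_eq h1
  exact LinearMap.range_eq_top.mp h2

open Polynomial in
/-- A polynomial matrix whose rows are independent at every point has a right inverse. -/
theorem exists_rightInverse_of_pointwise {m n : Type} [Fintype m] [Fintype n] [DecidableEq m]
    [DecidableEq n] (A : Matrix m n ℂ[X])
    (h : ∀ c : ℂ, LinearIndependent ℂ (A.map (eval c)).row) :
    ∃ B : Matrix n m ℂ[X], A * B = 1 := by
  rw [← Matrix.mulVec_surjective_iff_exists_right_inverse]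
  suffices hrange : LinearMap.range A.mulVecLin = ⊤ from LinearMap.range_eq_top.mp hrange
  by_contra hne
  -- A Nakayama argument: a proper image lies in a maximal submodule `N`, whose simple quotient is
  -- killed by some `X - c`.
  obtain ⟨N, hN, hle⟩ := (eq_top_or_exists_le_coatom (LinearMap.range A.mulVecLin)).resolve_left hne
  obtain ⟨I, hI, ⟨e⟩⟩ := isSimpleModule_iff_quot_maximal.mp (isSimpleModule_iff_isCoatom.mpr hN)
  obtain ⟨c, hc⟩ := exists_X_sub_C_mem_of_isMaximal hI
  have hsm : ∀ v : m → ℂ[X], (X - C c) • v ∈ N := by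
    intro v
    rw [← Submodule.Quotient.mk_eq_zero, Submodule.Quotient.mk_smul]
    apply e.injective
    rw [map_smul, map_zero]
    obtain ⟨y, hy⟩ := Ideal.Quotient.mk_surjective (e (Submodule.Quotient.mk v))
    rw [← hy]
    change Ideal.Quotient.mk I ((X - C c) * y) = 0
    exact Ideal.Quotient.eq_zero_iff_mem.mpr (I.mul_mem_right _ hc)
  apply hN.1
  rw [eq_top_iff]
  intro v _
  -- Solve the system at the point `c` and lift the solution by constants; the error is divisible by
  -- `X - c`, hence lies in `N`.
  obtain ⟨x, hx⟩ := mulVec_surjective_of_linearIndependent_row _ (h c) (fun i => eval c (v i))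
  have hdvd : ∀ i, (X - C c) ∣ (v - A.mulVec fun j => C (x j)) i := by
    intro i
    rw [dvd_iff_isRoot, IsRoot, Pi.sub_apply, eval_sub, sub_eq_zero, ← congrFun hx i]
    simp [Matrix.mulVec, dotProduct, eval_finsetSum]
  choose q hq using hdvd
  have : v = (A.mulVec fun j => C (x j)) + (X - C c) • q := by
    rw [← sub_eq_iff_eq_add']
    funext i
    rw [hq i, Pi.smul_apply, smul_eq_mul]
  rw [this]
  exact N.add_mem (hle ⟨_, rfl⟩) (hsm q)

/-- A surjection and an injection with a retraction, composing to zero and of complementary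
ranks, form a split exact sequence. -/
theorem exists_splitting {R m n q : Type*} [CommRing R] [Fintype m] [Fintype n] [Fintype q]
    [DecidableEq m] [DecidableEq n] [DecidableEq q] (e : n ≃ m ⊕ q)
    {P : Matrix m n R} {S : Matrix n m R} {J : Matrix n q R} {L : Matrix q n R}
    (hPS : P * S = 1) (hLJ : L * J = 1) (hPJ : P * J = 0) :
    ∃ S' : Matrix n m R, P * S' = 1 ∧ L * S' = 0 ∧ S' * P + J * L = 1 := by
  -- Subtracting `J * (L * S)` makes the section orthogonal to `L`; it remains a section because `P
  -- * J = 0`.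
  have h1 : P * (S - J * (L * S)) = 1 := by
    rw [Matrix.mul_sub, hPS, ← Matrix.mul_assoc, hPJ, Matrix.zero_mul, sub_zero]
  have h2 : L * (S - J * (L * S)) = 0 := by
    rw [Matrix.mul_sub, ← Matrix.mul_assoc L J, hLJ, Matrix.one_mul, sub_self]
  refine ⟨S - J * (L * S), h1, h2, ?_⟩
  have h3 : Matrix.fromRows P L * Matrix.fromCols (S - J * (L * S)) J = 1 := by
    rw [Matrix.fromRows_mul_fromCols, h1, h2, hPJ, hLJ, Matrix.fromBlocks_one]
  -- By the rank hypothesis `e` the block matrices are square, so a one-sided inverse is two-sided.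
  rw [Matrix.mul_eq_one_comm_of_equiv e.symm, Matrix.fromCols_mul_fromRows] at h3
  exact h3

theorem surjective_mulVecLin_of_mul_eq_one {R m n : Type*} [CommRing R] [Fintype m] [Fintype n]
    [DecidableEq m] {P : Matrix m n R} {S : Matrix n m R} (hPS : P * S = 1) :
    Function.Surjective P.mulVecLin := fun v => ⟨S.mulVec v, by simp [hPS]⟩

theorem range_eq_ker_of_splitting {R m n q : Type*} [CommRing R] [Fintype m] [Fintype n]
    [Fintype q] [DecidableEq n]
    {P : Matrix m n R} {S : Matrix n m R} {J : Matrix n q R} {L : Matrix q n R}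
    (hPJ : P * J = 0) (h : S * P + J * L = 1) :
    LinearMap.range J.mulVecLin = LinearMap.ker P.mulVecLin := by
  ext v
  constructor
  · rintro ⟨u, rfl⟩
    simp [hPJ]
  · intro hv
    have hv : P.mulVec v = 0 := hv
    refine ⟨L.mulVec v, ?_⟩
    have := congrArg (fun M => M.mulVec v) h
    simpa [Matrix.add_mulVec, ← Matrix.mulVec_mulVec, hv] using this

/-! ### Minimal bases of modules of polynomial vectors -/

theorem linearIndependent_update {R V ι : Type*} [CommRing R] [IsDomain R] [AddCommGroup V]
    [Module R V] [Fintype ι] [DecidableEq ι] {p : ι → V} (hp : LinearIndependent R p)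
    (c : ι → R) (i₀ : ι) (h0 : c i₀ ≠ 0) :
    LinearIndependent R (Function.update p i₀ (∑ i, c i • p i)) := by
  rw [Fintype.linearIndependent_iff] at hp ⊢
  intro q hq
  have hsum : ∑ i, q i • Function.update p i₀ (∑ i, c i • p i) i =
      ∑ i, (q i₀ * c i + if i = i₀ then 0 else q i) • p i := by
    rw [← Finset.add_sum_erase _ _ (Finset.mem_univ i₀)]
    simp only [add_smul, Finset.sum_add_distrib, Function.update_self, Finset.smul_sum, smul_smul]
    congr 1
    rw [← Finset.add_sum_erase (s := Finset.univ)
      (f := fun i => (if i = i₀ then 0 else q i) • p i) (h := Finset.mem_univ i₀)]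
    simp only [if_true, zero_smul, zero_add]
    refine Finset.sum_congr rfl fun i hi => ?_
    rw [Function.update_of_ne (Finset.ne_of_mem_erase hi), if_neg (Finset.ne_of_mem_erase hi)]
  rw [hsum] at hq
  have h1 := hp _ hq
  have h2 : q i₀ = 0 := by simpa [h0] using h1 i₀
  intro i
  by_cases hi : i = i₀
  · rw [hi, h2]
  · simpa [h2, hi] using h1 i

theorem span_range_update {R V ι : Type*} [CommRing R] [AddCommGroup V]
    [Module R V] [Fintype ι] [DecidableEq ι] (p : ι → V)
    (c : ι → R) (i₀ : ι) (h0 : IsUnit (c i₀)) :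
    Submodule.span R (Set.range (Function.update p i₀ (∑ i, c i • p i))) =
      Submodule.span R (Set.range p) := by
  set p' := Function.update p i₀ (∑ i, c i • p i) with hp'
  apply le_antisymm
  · rw [Submodule.span_le]
    rintro _ ⟨i, rfl⟩
    by_cases hi : i = i₀
    · rw [hi, hp', Function.update_self]
      exact Submodule.sum_mem _ fun i _ => Submodule.smul_mem _ _ (Submodule.subset_span ⟨i, rfl⟩)
    · rw [hp', Function.update_of_ne hi]
      exact Submodule.subset_span ⟨i, rfl⟩
  · rw [Submodule.span_le]
    have hne : ∀ i, i ≠ i₀ → p i ∈ Submodule.span R (Set.range p') := fun i hi =>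
      Submodule.subset_span ⟨i, by rw [hp', Function.update_of_ne hi]⟩
    rintro _ ⟨i, rfl⟩
    by_cases hi : i = i₀
    · subst hi
      have h1 : c i • p i = p' i - ∑ j ∈ Finset.univ.erase i, c j • p j := by
        rw [hp', Function.update_self, eq_sub_iff_add_eq, Finset.add_sum_erase _ (fun i => c i • p i)
          (Finset.mem_univ i)]
      have h2 : c i • p i ∈ Submodule.span R (Set.range p') := by
        rw [h1]
        refine Submodule.sub_mem _ (Submodule.subset_span ⟨i, rfl⟩) (Submodule.sum_mem _ fun j hj =>
          Submodule.smul_mem _ _ (hne j (Finset.ne_of_mem_erase hj)))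
      exact (Submodule.smul_mem_iff_of_isUnit _ h0).mp h2
    · exact hne i hi

open Polynomial

/-- A basis of a submodule of `F[X]^κ` with row degrees bounded by `b` whose coefficients in
degrees `b` are independent. -/
structure IsMinimalBasis {F ι κ : Type*} [Field F] (K : Submodule F[X] (κ → F[X]))
    (p : ι → κ → F[X]) (b : ι → ℕ) : Prop where
  linearIndependent : LinearIndependent F[X] p
  span_eq : Submodule.span F[X] (Set.range p) = K
  natDegree_le : ∀ i j, (p i j).natDegree ≤ b i
  linearIndependent_coeff : LinearIndependent F fun i j => (p i j).coeff (b i)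

/-- Take a basis whose degree bounds have minimal sum. A relation between the top coefficient
vectors would allow a row to be replaced by a combination of strictly smaller degree bound. -/
theorem exists_isMinimalBasis {F κ : Type*} [Field F] [Fintype κ] (K : Submodule F[X] (κ → F[X])) :
    ∃ (p : Fin (Module.finrank F[X] K) → κ → F[X]) (b : Fin (Module.finrank F[X] K) → ℕ),
      IsMinimalBasis K p b := by
  classical
  let Q : ℕ → Prop := fun s => ∃ (p : Fin (Module.finrank F[X] K) → κ → F[X])
    (b : Fin (Module.finrank F[X] K) → ℕ), LinearIndependent F[X] p ∧
      Submodule.span F[X] (Set.range p) = K ∧ (∀ i j, (p i j).natDegree ≤ b i) ∧ ∑ i, b i = s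
  have hQ : ∃ s, Q s := by
    let B := Module.finBasis F[X] K
    refine ⟨_, fun i => (B i : κ → F[X]), fun i => ∑ j, ((B i : κ → F[X]) j).natDegree,
      B.linearIndependent.map' K.subtype (Submodule.ker_subtype K), ?_, fun i j => ?_, rfl⟩
    · have h1 : Set.range (fun i => (B i : κ → F[X])) = K.subtype '' Set.range B := by
        rw [← Set.range_comp]; rfl
      rw [h1, Submodule.span_image, B.span_eq, Submodule.map_subtype_top]
    · exact Finset.single_le_sum (f := fun j => ((B i : κ → F[X]) j).natDegree)
        (fun _ _ => Nat.zero_le _) (Finset.mem_univ j)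
  obtain ⟨p, b, hli, hspan, hdeg, hsum⟩ := Nat.find_spec hQ
  refine ⟨p, b, hli, hspan, hdeg, ?_⟩
  by_contra hdep
  obtain ⟨g, hg, i₁, hi₁⟩ := Fintype.not_linearIndependent_iff.mp hdep
  obtain ⟨i₀, hi₀, hmax⟩ := (Finset.univ.filter fun i => g i ≠ 0).exists_max_image b
    ⟨i₁, by simpa using hi₁⟩
  have hg0 : g i₀ ≠ 0 := by simpa using hi₀
  have hmax : ∀ i, g i ≠ 0 → b i ≤ b i₀ := fun i hi => hmax i (by simpa using hi)
  -- The powers of `X` raise all rows in the relation to the bound `b i₀`, the largest among them.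
  -- Then the coefficient in degree `b i₀` cancels, and `c i₀` is a nonzero constant, so the
  -- exchange preserves the span.
  let c : Fin (Module.finrank F[X] K) → F[X] := fun i => C (g i) * X ^ (b i₀ - b i)
  have hc0 : c i₀ = C (g i₀) := by simp [c]
  have hcu : IsUnit (c i₀) := by rw [hc0]; exact isUnit_C.mpr hg0.isUnit
  have hli' := linearIndependent_update hli c i₀ hcu.ne_zero
  have hspan' := span_range_update p c i₀ hcu
  set v := ∑ i, c i • p i with hv
  have hvj : ∀ j, v j = ∑ i, C (g i) * (X ^ (b i₀ - b i) * p i j) := fun j => by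
    simp [hv, c, Finset.sum_apply, mul_assoc]
  have hvdeg : ∀ j, (v j).natDegree ≤ b i₀ := by
    intro j
    rw [hvj]
    refine natDegree_sum_le_of_forall_le _ _ fun i _ => ?_
    by_cases hi : g i = 0
    · simp [hi]
    · have := hmax i hi
      have := hdeg i j
      refine natDegree_mul_le.trans ?_
      rw [natDegree_C]
      have h2 := natDegree_mul_le (p := (X ^ (b i₀ - b i) : F[X])) (q := p i j)
      rw [natDegree_X_pow] at h2
      omega
  have hvcoeff : ∀ j, (v j).coeff (b i₀) = 0 := by
    intro j
    rw [hvj, finsetSum_coeff]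
    have := congrFun hg j
    rw [Finset.sum_apply] at this
    rw [Pi.zero_apply] at this
    rw [← this]
    refine Finset.sum_congr rfl fun i _ => ?_
    by_cases hi : g i = 0
    · simp [hi]
    · have := hmax i hi
      rw [coeff_C_mul, coeff_X_pow_mul', if_pos (by omega), Pi.smul_apply, smul_eq_mul]
      congr 2
      omega
  have hv0 : v ≠ 0 := by simpa using hli'.ne_zero i₀
  -- Needed for `b i₀ - 1` to be a genuine decrease: with bound zero the new row would be a constant
  -- vector with zero constant term.
  have hb0 : b i₀ ≠ 0 := by
    intro h0
    apply hv0
    funext j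
    have h1 := hvdeg j
    have h2 := hvcoeff j
    rw [h0] at h1 h2
    rw [eq_C_of_natDegree_le_zero h1, h2, C_0, Pi.zero_apply]
  have hvdeg' : ∀ j, (v j).natDegree ≤ b i₀ - 1 := fun j =>
    natDegree_le_pred (hvdeg j) (hvcoeff j)
  have hlt : ∑ i, Function.update b i₀ (b i₀ - 1) i < ∑ i, b i := by
    refine Finset.sum_lt_sum (fun i _ => ?_) ⟨i₀, Finset.mem_univ _, ?_⟩
    · by_cases hi : i = i₀
      · subst hi; simp
      · rw [Function.update_of_ne hi]
    · rw [Function.update_self]; omega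
  rw [hsum] at hlt
  refine Nat.find_min hQ hlt ⟨_, Function.update b i₀ (b i₀ - 1), hli', hspan'.trans hspan,
    fun i j => ?_, rfl⟩
  by_cases hi : i = i₀
  · subst hi
    simpa using hvdeg' j
  · simpa [Function.update_of_ne hi] using hdeg i j

namespace IsMinimalBasis

variable {F ι κ : Type*} [Field F] {K : Submodule F[X] (κ → F[X])}
  {p : ι → κ → F[X]} {b : ι → ℕ}

/-- Top terms cannot cancel. In the largest degree `deg (q i) + b i`, the coefficient of the sum is
a combination of the independent top vectors in which some leading coefficient of a `q i` occurs. -/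
theorem natDegree_add_le [Fintype ι] (h : IsMinimalBasis K p b) {q : ι → F[X]} {d : ℕ}
    (hd : ∀ j, ((∑ i, q i • p i) j).natDegree ≤ d) (i : ι) (hi : q i ≠ 0) :
    (q i).natDegree + b i ≤ d := by
  classical
  by_contra hlt
  obtain ⟨i₀, hi₀, hmax⟩ := (Finset.univ.filter fun i => q i ≠ 0).exists_max_image
    (fun i => (q i).natDegree + b i) ⟨i, by simpa using hi⟩
  have hq0 : q i₀ ≠ 0 := by simpa using hi₀
  have hmax : ∀ i, q i ≠ 0 → (q i).natDegree + b i ≤ (q i₀).natDegree + b i₀ :=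
    fun i hi => hmax i (by simpa using hi)
  set e := (q i₀).natDegree + b i₀ with he
  have hed : d < e := lt_of_lt_of_le (not_le.mp hlt) (hmax i hi)
  have h1 : ∑ i, (if q i = 0 then 0 else (q i).coeff (e - b i)) •
      (fun j => (p i j).coeff (b i)) = 0 := by
    funext j
    have h2 := coeff_eq_zero_of_natDegree_lt (lt_of_le_of_lt (hd j) hed)
    rw [Finset.sum_apply, finsetSum_coeff] at h2
    rw [Finset.sum_apply]
    refine Eq.trans ?_ h2
    refine Finset.sum_congr rfl fun i _ => ?_
    by_cases hi : q i = 0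
    · simp [hi]
    · have h3 := hmax i hi
      rw [if_neg hi, Pi.smul_apply, Pi.smul_apply, smul_eq_mul, smul_eq_mul]
      have h4 : e = (e - b i) + b i := by omega
      conv_rhs => rw [h4]
      exact (coeff_mul_add_eq_of_natDegree_le (by omega) (h.natDegree_le i j)).symm
  have h2 := Fintype.linearIndependent_iff.mp h.linearIndependent_coeff _ h1 i₀
  rw [if_neg hq0, he, Nat.add_sub_cancel] at h2
  exact hq0 (leadingCoeff_eq_zero.mp h2)

theorem mem (h : IsMinimalBasis K p b) (i : ι) : p i ∈ K := by
  rw [← h.span_eq]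
  exact Submodule.subset_span ⟨i, rfl⟩

theorem exists_eq_sum [Fintype ι] (h : IsMinimalBasis K p b) {v : κ → F[X]} (hv : v ∈ K) :
    ∃ q : ι → F[X], ∑ i, q i • p i = v := by
  rw [← h.span_eq] at hv
  exact (Submodule.mem_span_range_iff_exists_fun _).mp hv

/-- A relation at `c` gives a constant combination divisible by `X - c`. By saturation the quotient
lies in `K`; expanding it in the basis shows that each constant is a multiple of `X - c`, hence
zero. -/
theorem linearIndependent_eval [Fintype ι] (h : IsMinimalBasis K p b)
    (hK : ∀ (c : F) (v : κ → F[X]), (X - C c) • v ∈ K → v ∈ K) (c : F) :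
    LinearIndependent F fun i j => (p i j).eval c := by
  rw [Fintype.linearIndependent_iff]
  intro g hg
  have hdvd : ∀ j, (X - C c) ∣ (∑ i, C (g i) • p i) j := by
    intro j
    rw [dvd_iff_isRoot, IsRoot, Finset.sum_apply, eval_finsetSum]
    have := congrFun hg j
    rw [Finset.sum_apply] at this
    simpa using this
  choose v hv using hdvd
  have hv' : ∑ i, C (g i) • p i = (X - C c) • v := funext hv
  have hvK : v ∈ K := hK c v (hv' ▸ Submodule.sum_mem _ fun i _ => K.smul_mem _ (h.mem i))
  obtain ⟨q, rfl⟩ := h.exists_eq_sum hvK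
  rw [Finset.smul_sum, ← sub_eq_zero, ← Finset.sum_sub_distrib] at hv'
  simp only [smul_smul, ← sub_smul] at hv'
  intro i
  have h1 := Fintype.linearIndependent_iff.mp h.linearIndependent _ hv' i
  simpa using congrArg (eval c) h1

/-- This covers the other chart. At `c = 0`, the point at infinity, the values are the top
coefficients; elsewhere they are the values at `c⁻¹`, rescaled row by row by powers of `c`. -/
theorem linearIndependent_eval_reflect [Fintype ι] (h : IsMinimalBasis K p b)
    (hK : ∀ (c : F) (v : κ → F[X]), (X - C c) • v ∈ K → v ∈ K) (c : F) :
    LinearIndependent F fun i j => ((p i j).reflect (b i)).eval c := by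
  by_cases hc : c = 0
  · have : (fun i j => ((p i j).reflect (b i)).eval c) = fun i j => (p i j).coeff (b i) := by
      funext i j
      rw [hc, ← coeff_zero_eq_eval_zero, coeff_reflect, revAt_le (Nat.zero_le _), Nat.sub_zero]
    rw [this]
    exact h.linearIndependent_coeff
  · have h1 := (h.linearIndependent_eval hK c⁻¹).units_smul fun i => (Units.mk0 c hc) ^ b i
    convert h1 using 1
    funext i j
    have hinv := invertibleOfNonzero (inv_ne_zero hc)
    have h2 := eval₂_reflect_mul_pow (RingHom.id F) c⁻¹ (b i) (p i j) (h.natDegree_le i j)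
    rw [invOf_eq_inv, inv_inv, ← eval, ← eval] at h2
    simp only [Pi.smul_apply', Pi.smul_apply, Units.smul_def, Units.val_pow_eq_pow_val,
      Units.val_mk0, smul_eq_mul]
    rw [← h2, mul_comm, mul_assoc, ← mul_pow, inv_mul_cancel₀ hc, one_pow, mul_one]

/-- If all row degrees are at least `d`, the elements of `K` of degree at most `d` have the basis
elements of degree `d` as a basis. -/
theorem finrank_eq_card [Fintype ι] [Finite κ] (h : IsMinimalBasis K p b) {d : ℕ} (hd : ∀ i, d ≤ b i)
    {D : Submodule F (κ → F[X])} (hD : ∀ v, v ∈ D ↔ v ∈ K ∧ ∀ j, (v j).natDegree ≤ d) :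
    Module.finrank F D = Fintype.card {i // b i = d} := by
  classical
  have hmem : ∀ i : {i // b i = d}, p i.1 ∈ D := fun i =>
    (hD _).mpr ⟨h.mem i, fun j => (h.natDegree_le i j).trans i.2.le⟩
  have hli : LinearIndependent F fun i : {i // b i = d} => p i.1 := by
    have h1 : LinearIndependent F p := h.linearIndependent.restrict_scalars' F
    exact h1.comp _ Subtype.val_injective
  have hspan : Submodule.span F (Set.range fun i : {i // b i = d} => p i.1) = D := by
    apply le_antisymm
    · rw [Submodule.span_le]
      rintro _ ⟨i, rfl⟩
      exact hmem i
    · intro v hv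
      obtain ⟨hvK, hvd⟩ := (hD v).mp hv
      obtain ⟨q, rfl⟩ := h.exists_eq_sum hvK
      refine Submodule.sum_mem _ fun i _ => ?_
      by_cases hi : q i = 0
      · simp [hi]
      · have h1 := h.natDegree_add_le hvd i hi
        have h2 := hd i
        rw [eq_C_of_natDegree_le_zero (p := q i) (by omega)]
        have h3 : (C ((q i).coeff 0) : F[X]) • p i = ((q i).coeff 0) • p i := by
          funext j
          simp [smul_eq_C_mul]
        rw [h3]
        exact Submodule.smul_mem _ _ (Submodule.subset_span ⟨⟨i, by omega⟩, rfl⟩)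
  rw [← hspan, finrank_span_eq_card hli]

end IsMinimalBasis

/-! ### Syzygies of the Jacobian and the splitting of the normal bundle -/

/-- If `T k` is a product of units from the two charts, then `O(k)` is trivial. Maps in both
directions between `O(k)` and `O(0)` are then nonzero, which excludes either sign of `k`. -/
theorem eq_zero_of_toLaurent_mul_toLaurentInv_eq_T {f g : ℂ[X]} (hf : IsUnit f) (hg : IsUnit g)
    {k : ℤ} (h : Polynomial.toLaurent f * toLaurentInv g = LaurentPolynomial.T k) : k = 0 := by
  obtain ⟨f', hf'⟩ := hf.exists_left_inv
  obtain ⟨g', hg'⟩ := hg.exists_left_inv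
  have h1 : LaurentPolynomial.T 0 * Polynomial.toLaurent f =
      LaurentPolynomial.T k * toLaurentInv g' := by
    rw [← h, mul_assoc, ← map_mul, mul_comm g, hg', map_one, mul_one, LaurentPolynomial.T_zero,
      one_mul]
  have h2 : LaurentPolynomial.T k * Polynomial.toLaurent f' =
      LaurentPolynomial.T 0 * toLaurentInv g := by
    rw [← h, mul_comm, ← mul_assoc, ← map_mul, hf', map_one, LaurentPolynomial.T_zero]
  rcases lt_trichotomy k 0 with hk | hk | hk
  · exact absurd (eq_zero_of_toLaurent_eq hk h1) hf.ne_zero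
  · exact hk
  · have h3 := eq_zero_of_toLaurent_eq hk h2
    rw [h3, zero_mul] at hf'
    exact absurd hf' zero_ne_one

theorem prod_T {ι : Type*} (s : Finset ι) (b : ι → ℤ) :
    ∏ i ∈ s, (LaurentPolynomial.T (b i) : ℂ[T;T⁻¹]) = LaurentPolynomial.T (∑ i ∈ s, b i) := by
  classical
  induction s using Finset.induction_on with
  | empty => simp
  | insert i s hi ih => rw [Finset.prod_insert hi, Finset.sum_insert hi, ih, LaurentPolynomial.T_add]

theorem eval_aeval {σ : Type*} (c : ℂ) (x : σ → ℂ[X]) (g : MvPolynomial σ ℂ) :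
    Polynomial.eval c (MvPolynomial.aeval x g) =
      MvPolynomial.eval (fun i => Polynomial.eval c (x i)) g := by
  induction g using MvPolynomial.induction_on with
  | C a => simp
  | add p q hp hq => simp only [map_add, Polynomial.eval_add, hp, hq]
  | mul_X p i hp => simp [hp]

theorem isUnit_det_submatrix {R m n : Type*} [CommRing R] [Fintype m] [Fintype n] [DecidableEq m]
    {A : Matrix m n R} {B : Matrix n m R} (h : A * B = 1) (e : m ≃ n) :
    IsUnit (A.submatrix id e).det ∧ IsUnit (B.submatrix e id).det := by
  have h1 : (A.submatrix id e).det * (B.submatrix e id).det = 1 := by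
    rw [← Matrix.det_mul, Matrix.submatrix_mul_equiv, h, Matrix.submatrix_id_id, Matrix.det_one]
  exact ⟨IsUnit.of_mul_eq_one _ h1, IsUnit.of_mul_eq_one _ ((mul_comm _ _).trans h1)⟩

namespace RatCurve

variable {n m : ℕ}

/-- The Jacobian matrix on the chart `s ≠ 0`. -/
noncomputable def jac₀ (f : RatCurve n m) : Matrix (Fin (m + 1)) (Fin 2) ℂ[X] :=
  Matrix.of fun j i => MvPolynomial.aeval ![1, Polynomial.X] (MvPolynomial.pderiv i (f.form j))

/-- The Jacobian matrix on the chart `t ≠ 0`. -/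
noncomputable def jac₁ (f : RatCurve n m) : Matrix (Fin (m + 1)) (Fin 2) ℂ[X] :=
  Matrix.of fun j i => MvPolynomial.aeval ![Polynomial.X, 1] (MvPolynomial.pderiv i (f.form j))

theorem toLaurent_jac₀ (f : RatCurve n m) :
    f.jac₀.map Polynomial.toLaurent =
      (LaurentPolynomial.T ((n - 1 : ℕ) : ℤ) : ℂ[T;T⁻¹]) • f.jac₁.map toLaurentInv := by
  ext1 j i
  change Polynomial.toLaurent (MvPolynomial.aeval ![1, Polynomial.X] _) = _ * toLaurentInv _
  rw [← QCoh.chart_compat, QCoh.chart_compat_inv (f.homog j).pderiv]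
  rfl

theorem IsImmersion.jac₀_row {f : RatCurve n m} (hf : f.IsImmersion) (c : ℂ) :
    LinearIndependent ℂ (f.jac₀.transpose.map (Polynomial.eval c)).row := by
  have h := hf ![1, c] (fun h => one_ne_zero (congrFun h 0))
  convert h using 1
  funext i j
  refine (eval_aeval c _ _).trans ?_
  congr 2
  funext i
  fin_cases i <;> simp

theorem IsImmersion.jac₁_row {f : RatCurve n m} (hf : f.IsImmersion) (c : ℂ) :
    LinearIndependent ℂ (f.jac₁.transpose.map (Polynomial.eval c)).row := by
  have h := hf ![c, 1] (fun h => one_ne_zero (congrFun h 1))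
  convert h using 1
  funext i j
  refine (eval_aeval c _ _).trans ?_
  congr 2
  funext i
  fin_cases i <;> simp

/-- The syzygies of the partial derivatives on the chart `s ≠ 0`. -/
noncomputable def syz (f : RatCurve n m) : Submodule ℂ[X] (Fin (m + 1) → ℂ[X]) :=
  LinearMap.ker f.jac₀.transpose.mulVecLin

theorem mem_syz {f : RatCurve n m} {v : Fin (m + 1) → ℂ[X]} :
    v ∈ f.syz ↔ ∀ i, ∑ j, f.jac₀ j i * v j = 0 := by
  rw [syz, LinearMap.mem_ker]
  exact funext_iff

/-- A kernel with torsion-free target is saturated, as `linearIndependent_eval` requires. -/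
theorem mem_syz_of_smul_mem (f : RatCurve n m) (c : ℂ) (v : Fin (m + 1) → ℂ[X])
    (h : (X - C c) • v ∈ f.syz) : v ∈ f.syz := by
  rw [syz, LinearMap.mem_ker, map_smul] at h
  exact (smul_eq_zero.mp h).resolve_left (X_sub_C_ne_zero c)

theorem IsImmersion.exists_leftInverse_jac₀ {f : RatCurve n m} (hf : f.IsImmersion) :
    ∃ L : Matrix (Fin 2) (Fin (m + 1)) ℂ[X], L * f.jac₀ = 1 := by
  obtain ⟨B, hB⟩ := exists_rightInverse_of_pointwise _ hf.jac₀_row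
  exact ⟨B.transpose, by
    rw [← Matrix.transpose_inj, Matrix.transpose_mul, Matrix.transpose_transpose, hB,
      Matrix.transpose_one]⟩

theorem IsImmersion.exists_leftInverse_jac₁ {f : RatCurve n m} (hf : f.IsImmersion) :
    ∃ L : Matrix (Fin 2) (Fin (m + 1)) ℂ[X], L * f.jac₁ = 1 := by
  obtain ⟨B, hB⟩ := exists_rightInverse_of_pointwise _ hf.jac₁_row
  exact ⟨B.transpose, by
    rw [← Matrix.transpose_inj, Matrix.transpose_mul, Matrix.transpose_transpose, hB,
      Matrix.transpose_one]⟩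

theorem IsImmersion.finrank_syz {f : RatCurve n m} (hf : f.IsImmersion) :
    Module.finrank ℂ[X] f.syz + 2 = m + 1 := by
  obtain ⟨B, hB⟩ := exists_rightInverse_of_pointwise _ hf.jac₀_row
  have h1 := (f.jac₀.transpose.mulVecLin.quotKerEquivOfSurjective
    (surjective_mulVecLin_of_mul_eq_one hB)).finrank_eq
  have h2 := Submodule.finrank_quotient_add_finrank (LinearMap.ker f.jac₀.transpose.mulVecLin)
  rw [h1, Module.finrank_fintype_fun_eq_card, Module.finrank_fintype_fun_eq_card, Fintype.card_fin,
    Fintype.card_fin] at h2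
  rw [syz]
  omega

/-- The morphism `O(n)^(m+1) → ⊕ᵢ O(n + b i)` given by the homogenizations of the rows `p i`. -/
noncomputable def rowHom {r : ℕ} (n : ℕ) (p : Fin r → Fin (m + 1) → ℂ[X]) (b : Fin r → ℕ)
    (h : ∀ i j, (p i j).natDegree ≤ b i) :
    QCoh.Hom (QCoh.lineSum fun _ : Fin (m + 1) => (n : ℤ))
      (QCoh.lineSum fun i => (n : ℤ) + b i) where
  f₀ := (Matrix.of p).mulVecLin
  f₁ := (Matrix.of fun i j => (p i j).reflect (b i)).mulVecLin
  f₀₁ := ((Matrix.of p).map Polynomial.toLaurent).mulVecLin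
  comm₀ := by
    intro u
    funext i
    change ∑ j, Polynomial.toLaurent (p i j) * Polynomial.toLaurent (u j) =
      Polynomial.toLaurent (∑ j, p i j * u j)
    simp only [map_sum, map_mul]
  comm₁ := by
    intro u
    funext i
    change ∑ j, Polynomial.toLaurent (p i j) * (LaurentPolynomial.T (n : ℤ) * toLaurentInv (u j)) =
      LaurentPolynomial.T ((n : ℤ) + b i) * toLaurentInv (∑ j, (p i j).reflect (b i) * u j)
    rw [map_sum, Finset.mul_sum]
    refine Finset.sum_congr rfl fun j _ => ?_
    rw [toLaurent_eq_T_mul_toLaurentInv_reflect (h i j), LaurentPolynomial.T_add, map_mul]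
    ring

/-- On each chart the rows are pointwise independent, so they have a right inverse; the Jacobian has
a left inverse because the curve is immersed. The ranks are complementary and the composition is
zero, so the sequence is split exact and its cokernel is the sum of line bundles. -/
theorem IsImmersion.normalBundle_isomorphic {f : RatCurve n m} (hf : f.IsImmersion) {r : ℕ}
    {p : Fin r → Fin (m + 1) → ℂ[X]} {b : Fin r → ℕ} (hp : IsMinimalBasis f.syz p b)
    (hr : r + 2 = m + 1) :
    f.normalBundle.Isomorphic (QCoh.lineSum fun i => (n : ℤ) + b i) ∧
      ∑ i, b i = 2 * (n - 1) := by
  set P₀ : Matrix (Fin r) (Fin (m + 1)) ℂ[X] := Matrix.of p with hP₀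
  set P₁ : Matrix (Fin r) (Fin (m + 1)) ℂ[X] :=
    Matrix.of (fun i j => (p i j).reflect (b i)) with hP₁
  have e : Fin r ⊕ Fin 2 ≃ Fin (m + 1) := finSumFinEquiv.trans (finCongr hr)
  have hP : P₀.map Polynomial.toLaurent =
      Matrix.diagonal (fun i => (LaurentPolynomial.T (b i : ℤ) : ℂ[T;T⁻¹])) *
        P₁.map toLaurentInv := by
    ext1 i j
    rw [Matrix.diagonal_mul]
    exact toLaurent_eq_T_mul_toLaurentInv_reflect (hp.natDegree_le i j)
  have hPJ₀ : P₀ * f.jac₀ = 0 := by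
    ext1 i k
    have := mem_syz.mp (hp.mem i) k
    rw [Matrix.mul_apply, Matrix.zero_apply, ← this]
    exact Finset.sum_congr rfl fun j _ => mul_comm _ _
  have hPJ₁ : P₁ * f.jac₁ = 0 := by
    have h1 := congrArg (fun A => A.map (Polynomial.toLaurent : ℂ[X] →+* ℂ[T;T⁻¹])) hPJ₀
    simp only [Matrix.map_mul] at h1
    have h1' : P₀.map Polynomial.toLaurent * f.jac₀.map Polynomial.toLaurent = 0 := by
      rw [h1]; ext1 i j; simp
    -- The relation passes to the second chart because the two chart matrices differ only by powers
    -- of `T`, which are invertible.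
    rw [hP, toLaurent_jac₀, Matrix.mul_smul, Matrix.mul_assoc, ← Matrix.map_mul] at h1'
    ext1 i k
    have h2 := congrFun (congrFun h1' i) k
    rw [Matrix.smul_apply, Matrix.diagonal_mul, Matrix.map_apply, smul_eq_mul, ← mul_assoc,
      Matrix.zero_apply, ((LaurentPolynomial.isUnit_T _).mul
        (LaurentPolynomial.isUnit_T _)).mul_right_eq_zero] at h2
    exact toLaurentInv_injective (h2.trans (map_zero _).symm)
  obtain ⟨S₀, hS₀⟩ := exists_rightInverse_of_pointwise P₀
    (hp.linearIndependent_eval f.mem_syz_of_smul_mem)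
  obtain ⟨S₁, hS₁⟩ := exists_rightInverse_of_pointwise P₁
    (hp.linearIndependent_eval_reflect f.mem_syz_of_smul_mem)
  obtain ⟨L₀, hL₀⟩ := hf.exists_leftInverse_jac₀
  obtain ⟨L₁, hL₁⟩ := hf.exists_leftInverse_jac₁
  obtain ⟨S₀, hPS₀, hLS₀, hs₀⟩ := exists_splitting e.symm hS₀ hL₀ hPJ₀
  obtain ⟨S₁, hPS₁, hLS₁, hs₁⟩ := exists_splitting e.symm hS₁ hL₁ hPJ₁
  have map_mul_toLaurent {x y z : Type} [Fintype y] (A : Matrix x y ℂ[X]) (B : Matrix y z ℂ[X]) :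
      A.map Polynomial.toLaurent * B.map Polynomial.toLaurent =
        (A * B).map (Polynomial.toLaurent : ℂ[X] →+* ℂ[T;T⁻¹]) := (Matrix.map_mul).symm
  have map_one_toLaurent (x : Type) [DecidableEq x] :
      (1 : Matrix x x ℂ[X]).map (Polynomial.toLaurent : ℂ[X] →+* ℂ[T;T⁻¹]) = 1 :=
    Matrix.map_one _ (map_zero _) (map_one _)
  refine ⟨?_, ?_⟩
  · have hPS₀₁ : P₀.map Polynomial.toLaurent * S₀.map Polynomial.toLaurent = 1 := by
      rw [map_mul_toLaurent, hPS₀, map_one_toLaurent]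
    have hPJ₀₁ : P₀.map Polynomial.toLaurent * f.jac₀.map Polynomial.toLaurent = 0 := by
      rw [map_mul_toLaurent, hPJ₀]; ext1 i j; simp
    have hs₀₁ : S₀.map Polynomial.toLaurent * P₀.map Polynomial.toLaurent +
        f.jac₀.map Polynomial.toLaurent * L₀.map Polynomial.toLaurent = 1 := by
      rw [map_mul_toLaurent, map_mul_toLaurent, ← Matrix.map_add _ (map_add _), hs₀,
        map_one_toLaurent]
    refine QCoh.isomorphic_coker _ (rowHom n p b hp.natDegree_le)
      (surjective_mulVecLin_of_mul_eq_one hPS₀) (surjective_mulVecLin_of_mul_eq_one hPS₁)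
      (surjective_mulVecLin_of_mul_eq_one hPS₀₁) (range_eq_ker_of_splitting hPJ₀ hs₀)
      (range_eq_ker_of_splitting hPJ₁ hs₁) ?_
    have h1 : (Matrix.of fun j i => (MvPolynomial.aeval ![1, LaurentPolynomial.T 1]
        (MvPolynomial.pderiv i (f.form j)) : ℂ[T;T⁻¹])) = f.jac₀.map Polynomial.toLaurent := by
      ext1 j i
      exact QCoh.chart_compat _
    change LinearMap.range (Matrix.mulVecLin (Matrix.of fun j i =>
      (MvPolynomial.aeval ![1, LaurentPolynomial.T 1]
        (MvPolynomial.pderiv i (f.form j)) : ℂ[T;T⁻¹]))) = _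
    rw [h1]
    exact range_eq_ker_of_splitting hPJ₀₁ hs₀₁
  · have hA : Matrix.fromRows P₀ L₀ * Matrix.fromCols S₀ f.jac₀ = 1 := by
      rw [Matrix.fromRows_mul_fromCols, hPS₀, hLS₀, hPJ₀, hL₀, Matrix.fromBlocks_one]
    have hB : Matrix.fromRows P₁ L₁ * Matrix.fromCols S₁ f.jac₁ = 1 := by
      rw [Matrix.fromRows_mul_fromCols, hPS₁, hLS₁, hPJ₁, hL₁, Matrix.fromBlocks_one]
    have hJ : f.jac₁.map toLaurentInv =
        (LaurentPolynomial.T (-((n - 1 : ℕ) : ℤ)) : ℂ[T;T⁻¹]) •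
          f.jac₀.map Polynomial.toLaurent := by
      rw [toLaurent_jac₀, smul_smul, ← LaurentPolynomial.T_add, neg_add_cancel,
        LaurentPolynomial.T_zero, one_smul]
    -- The degree is read off by multiplying an invertible matrix of one chart by one of the other.
    -- The product is block triangular with determinant `T (∑ b i - 2(n - 1))`, while both factors
    -- have unit determinant, so the exponent is zero.
    have hAB : (Matrix.fromRows P₀ L₀).map Polynomial.toLaurent *
        (Matrix.fromCols S₁ f.jac₁).map toLaurentInv =
        Matrix.fromBlocks (Matrix.diagonal fun i => (LaurentPolynomial.T (b i : ℤ) : ℂ[T;T⁻¹])) 0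
          (L₀.map Polynomial.toLaurent * S₁.map toLaurentInv)
          ((LaurentPolynomial.T (-((n - 1 : ℕ) : ℤ)) : ℂ[T;T⁻¹]) • 1) := by
      have h1 : (Matrix.fromRows P₀ L₀).map (Polynomial.toLaurent : ℂ[X] →+* ℂ[T;T⁻¹]) =
          Matrix.fromRows (P₀.map Polynomial.toLaurent) (L₀.map Polynomial.toLaurent) := by
        ext (i | i) j <;> rfl
      have h2 : (Matrix.fromCols S₁ f.jac₁).map toLaurentInv =
          Matrix.fromCols (S₁.map toLaurentInv) (f.jac₁.map toLaurentInv) := by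
        ext i (j | j) <;> rfl
      rw [h1, h2, Matrix.fromRows_mul_fromCols]
      congr 1
      · rw [hP, Matrix.mul_assoc, ← Matrix.map_mul, hPS₁,
          Matrix.map_one _ (map_zero _) (map_one _), Matrix.mul_one]
      · rw [hP, Matrix.mul_assoc, ← Matrix.map_mul, hPJ₁]
        ext1 i j
        simp
      · rw [hJ, Matrix.mul_smul, map_mul_toLaurent, hL₀, map_one_toLaurent]
    have hdet := congrArg Matrix.det hAB
    rw [Matrix.det_fromBlocks_zero₁₂, Matrix.det_diagonal, prod_T, Matrix.det_smul,
      Matrix.det_one, mul_one, Fintype.card_fin, LaurentPolynomial.T_pow,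
      ← LaurentPolynomial.T_add, ← Matrix.submatrix_id_id (_ * _),
      ← Matrix.submatrix_mul_equiv _ _ _ e _, Matrix.det_mul, Matrix.submatrix_map,
      Matrix.submatrix_map] at hdet
    have h0 := eq_zero_of_toLaurent_mul_toLaurentInv_eq_T (isUnit_det_submatrix hA e).1
      (isUnit_det_submatrix hB e).2
      (by rw [RingHom.map_det, RingHom.map_det]; exact hdet)
    push_cast at h0
    have : ((∑ i, b i : ℕ) : ℤ) = ((2 * (n - 1) : ℕ) : ℤ) := by push_cast; linarith
    exact_mod_cast this

end RatCurve

/-! ### Quadratic syzygies of the rational normal curve -/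

/-- The coefficient of `X ^ (q + 2)` in `∑ cᵢ Xⁱ wᵢ` for quadratic polynomials `wᵢ`. -/
theorem coeff_sum_C_mul_X_pow_mul {N : ℕ} (c : ℕ → ℂ) {w : ℕ → ℂ[X]}
    (hdeg : ∀ i, (w i).natDegree ≤ 2) (hw : ∀ i, N ≤ i → w i = 0) (q : ℕ) :
    (∑ i ∈ Finset.range N, C (c i) * X ^ i * w i).coeff (q + 2) =
      c q * (w q).coeff 2 + c (q + 1) * (w (q + 1)).coeff 1 + c (q + 2) * (w (q + 2)).coeff 0 := by
  have hF : ∀ i, (C (c i) * X ^ i * w i).coeff (q + 2) =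
      c i * if i ≤ q + 2 then (w i).coeff (q + 2 - i) else 0 := fun i => by
    rw [mul_assoc, coeff_C_mul, coeff_X_pow_mul']
  rw [finsetSum_coeff]
  have h1 : ∑ i ∈ Finset.range N, (C (c i) * X ^ i * w i).coeff (q + 2) =
      ∑ i ∈ Finset.range (N + (q + 3)), (C (c i) * X ^ i * w i).coeff (q + 2) :=
    Finset.sum_subset (Finset.range_mono (by omega)) fun i _ hi => by
      rw [hw i (by simpa using hi), mul_zero, coeff_zero]
  have h2 : ∑ i ∈ ({q, q + 1, q + 2} : Finset ℕ), (C (c i) * X ^ i * w i).coeff (q + 2) =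
      ∑ i ∈ Finset.range (N + (q + 3)), (C (c i) * X ^ i * w i).coeff (q + 2) := by
    refine Finset.sum_subset (fun i hi => ?_) fun i _ hi => ?_
    · simp only [Finset.mem_insert, Finset.mem_singleton] at hi
      rw [Finset.mem_range]
      omega
    · simp only [Finset.mem_insert, Finset.mem_singleton, not_or] at hi
      rw [hF]
      split_ifs with h
      · rw [coeff_eq_zero_of_natDegree_lt (lt_of_le_of_lt (hdeg i) (by omega)), mul_zero]
      · rw [mul_zero]
  rw [h1, ← h2, Finset.sum_insert (by simp), Finset.sum_pair (by simp), hF, hF, hF,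
    if_pos (by omega), if_pos (by omega), if_pos (by omega)]
  rw [show q + 2 - q = 2 by omega, show q + 2 - (q + 1) = 1 by omega,
    show q + 2 - (q + 2) = 0 by omega]
  ring

/-- In each degree the two relations involve only three coefficients: the quadratic, linear and
constant ones of three consecutive entries. Once one of the outer two is known to vanish, the two
equations kill the others. -/
theorem eq_zero_of_sum_eq_zero {n : ℕ} {W : Fin (n + 1) → ℂ[X]} (hdeg : ∀ i, (W i).natDegree ≤ 2)
    (h2 : ∀ i : Fin (n + 1), (i : ℕ) + 2 ≤ n → (W i).coeff 2 = 0)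
    (hA : ∑ i : Fin (n + 1), X ^ (i : ℕ) * W i = 0)
    (hB : ∑ i : Fin (n + 1), C ((i : ℕ) : ℂ) * X ^ (i : ℕ) * W i = 0) : W = 0 := by
  -- Shifting the index by two and padding with zeros gives the boundary degrees the same form as
  -- the others.
  let w : ℕ → ℂ[X] := fun i =>
    if h : 2 ≤ i ∧ i < n + 3 then W ⟨i - 2, by omega⟩ else 0
  have hwW : ∀ i : Fin (n + 1), w (i + 2) = W i := fun i => by
    simp [w, i.2]
  have hwdeg : ∀ i, (w i).natDegree ≤ 2 := fun i => by
    simp only [w]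
    split_ifs
    · exact hdeg _
    · simp
  have hw : ∀ i, n + 3 ≤ i → w i = 0 := fun i hi => dif_neg (by omega)
  have hsum : ∀ c : ℕ → ℂ, ∑ i ∈ Finset.range (n + 3), C (c i) * X ^ i * w i =
      X ^ 2 * ∑ i : Fin (n + 1), C (c (i + 2)) * X ^ (i : ℕ) * W i := fun c => by
    rw [Finset.sum_range_succ', Finset.sum_range_succ',
      ← Fin.sum_univ_eq_sum_range (fun i => C (c (i + 1 + 1)) * X ^ (i + 1 + 1) * w (i + 1 + 1))]
    have h0 : w 0 = 0 := dif_neg (by omega)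
    have h1 : w (0 + 1) = 0 := dif_neg (by omega)
    rw [h0, h1, mul_zero, mul_zero, add_zero, add_zero, Finset.mul_sum]
    refine Finset.sum_congr rfl fun i _ => ?_
    rw [show w (i + 1 + 1) = W i from hwW i, pow_succ, pow_succ]
    ring
  have e1 : ∀ q, (w q).coeff 2 + (w (q + 1)).coeff 1 + (w (q + 2)).coeff 0 = 0 := fun q => by
    have h := coeff_sum_C_mul_X_pow_mul (fun _ => 1) hwdeg hw q
    rw [hsum] at h
    simp only [C_1, one_mul, hA, mul_zero, coeff_zero] at h
    exact h.symm
  -- The weights `i - 2` undo the index shift.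
  have e2 : ∀ q : ℕ, ((q : ℂ) - 2) * (w q).coeff 2 + ((q : ℂ) - 1) * (w (q + 1)).coeff 1 +
      (q : ℂ) * (w (q + 2)).coeff 0 = 0 := fun q => by
    have h := coeff_sum_C_mul_X_pow_mul (fun i => (i : ℂ) - 2) hwdeg hw q
    rw [hsum] at h
    simp only [Nat.cast_add, Nat.cast_ofNat, add_sub_cancel_right, hB, mul_zero, coeff_zero] at h
    rw [h]
    push_cast
    ring
  have e3 : ∀ q, (w q).coeff 2 = 0 ∧ (w (q + 1)).coeff 1 = 0 ∧ (w (q + 2)).coeff 0 = 0 := by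
    intro q
    -- Up to `n` the quadratic coefficient of `w q` vanishes by `h2` or by padding; beyond `n` the
    -- entry `w (q + 2)` lies in the padding.
    by_cases hq : q ≤ n
    · have h0 : (w q).coeff 2 = 0 := by
        simp only [w]
        split_ifs with h
        · exact h2 _ (by simp only; omega)
        · simp
      have h3 : (w (q + 2)).coeff 0 = 0 := by
        linear_combination e2 q - ((q : ℂ) - 1) * e1 q + h0
      exact ⟨h0, by linear_combination e1 q - h0 - h3, h3⟩
    · have h3 : (w (q + 2)).coeff 0 = 0 := by rw [hw _ (by omega), coeff_zero]
      have h0 : (w q).coeff 2 = 0 := by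
        linear_combination ((q : ℂ) - 1) * e1 q - e2 q + h3
      exact ⟨h0, by linear_combination e1 q - h0 - h3, h3⟩
  funext i
  ext q
  rw [← hwW i, Pi.zero_apply, coeff_zero]
  by_cases hq : 2 < q
  · exact coeff_eq_zero_of_natDegree_lt (lt_of_le_of_lt (hwdeg _) hq)
  · interval_cases q
    · exact (e3 i).2.2
    · exact (e3 (i + 1)).2.1
    · exact (e3 (i + 2)).1

/-- The quadratic syzygies of the partial derivatives of the rational normal curve: the
combinations `∑ⱼ hⱼ Eⱼ` of `Eⱼ = X² eⱼ - 2 X eⱼ₊₁ + eⱼ₊₂`. -/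
noncomputable def quadSyz (n : ℕ) : (Fin (n - 1) → ℂ) →ₗ[ℂ] (Fin (n + 1) → ℂ[X]) :=
  ∑ j : Fin (n - 1), (LinearMap.proj j).smulRight
    ((Pi.single ⟨j, by omega⟩ (X ^ 2) : Fin (n + 1) → ℂ[X]) +
      (Pi.single ⟨j + 1, by omega⟩ (-2 * X) : Fin (n + 1) → ℂ[X]) +
      (Pi.single ⟨j + 2, by omega⟩ 1 : Fin (n + 1) → ℂ[X]))

theorem quadSyz_apply {n : ℕ} (h : Fin (n - 1) → ℂ) (i : Fin (n + 1)) :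
    quadSyz n h i = ∑ j : Fin (n - 1), C (h j) *
      ((Pi.single ⟨j, by omega⟩ (X ^ 2) : Fin (n + 1) → ℂ[X]) i +
        (Pi.single ⟨j + 1, by omega⟩ (-2 * X) : Fin (n + 1) → ℂ[X]) i +
        (Pi.single ⟨j + 2, by omega⟩ 1 : Fin (n + 1) → ℂ[X]) i) := by
  simp [quadSyz, smul_eq_C_mul, mul_add]

theorem sum_mul_quadSyz {n : ℕ} (h : Fin (n - 1) → ℂ) (c : Fin (n + 1) → ℂ[X]) :
    ∑ i, c i * quadSyz n h i = ∑ j : Fin (n - 1), C (h j) *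
      (c ⟨j, by omega⟩ * X ^ 2 - 2 * c ⟨j + 1, by omega⟩ * X + c ⟨j + 2, by omega⟩) := by
  simp only [quadSyz_apply, Finset.mul_sum]
  rw [Finset.sum_comm]
  refine Finset.sum_congr rfl fun j _ => ?_
  simp only [mul_left_comm (c _), ← Finset.mul_sum, mul_add, Finset.sum_add_distrib]
  simp only [Pi.single_apply, mul_ite, mul_zero, Finset.sum_ite_eq',
    Finset.mem_univ, if_true]
  ring

theorem natDegree_quadSyz_le {n : ℕ} (h : Fin (n - 1) → ℂ) (i : Fin (n + 1)) :
    (quadSyz n h i).natDegree ≤ 2 := by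
  rw [quadSyz_apply]
  refine natDegree_sum_le_of_forall_le _ _ fun j _ => (natDegree_C_mul_le _ _).trans ?_
  refine natDegree_add_le_of_degree_le (natDegree_add_le_of_degree_le ?_ ?_) ?_ <;>
  · rw [Pi.single_apply]
    split_ifs
    · compute_degree
      try norm_num
    · simp

theorem coeff_two_quadSyz {n : ℕ} (h : Fin (n - 1) → ℂ) (j : Fin (n - 1)) :
    (quadSyz n h ⟨j, by omega⟩).coeff 2 = h j := by
  rw [quadSyz_apply, finsetSum_coeff, Finset.sum_eq_single j]
  · simp
  · intro i _ hij
    have hij' : (j : ℕ) ≠ i := fun h => hij (Fin.ext h.symm)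
    have h1 : (-2 * X : ℂ[X]).coeff 2 = 0 := coeff_eq_zero_of_natDegree_lt (by
      have : (-2 * X : ℂ[X]).natDegree ≤ 1 := by compute_degree
      omega)
    rw [coeff_C_mul, coeff_add, coeff_add]
    simp only [Pi.single_apply, Fin.mk.injEq, hij', if_false, coeff_zero, zero_add]
    split_ifs <;> simp only [coeff_one, h1, coeff_zero, add_zero, mul_zero, if_neg two_ne_zero]
  · simp

theorem quadSyz_injective (n : ℕ) : Function.Injective (quadSyz n) := fun h h' heq => by
  funext j
  rw [← coeff_two_quadSyz h j, heq, coeff_two_quadSyz]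

theorem sum_X_pow_mul_quadSyz {n : ℕ} (h : Fin (n - 1) → ℂ) :
    ∑ i : Fin (n + 1), X ^ (i : ℕ) * quadSyz n h i = 0 := by
  rw [sum_mul_quadSyz]
  refine Finset.sum_eq_zero fun j _ => ?_
  simp only [pow_add]
  ring

theorem sum_C_mul_X_pow_mul_quadSyz {n : ℕ} (h : Fin (n - 1) → ℂ) :
    ∑ i : Fin (n + 1), C ((i : ℕ) : ℂ) * X ^ (i : ℕ) * quadSyz n h i = 0 := by
  rw [sum_mul_quadSyz]
  refine Finset.sum_eq_zero fun j _ => ?_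
  simp only [pow_add, Nat.cast_add, C_add, Nat.cast_ofNat, Nat.cast_one, C_1, C_ofNat]
  ring

/-- Subtract the combination with the same quadratic coefficients in the first `n - 1` entries;
`eq_zero_of_sum_eq_zero` kills the difference. -/
theorem eq_quadSyz {n : ℕ} {W : Fin (n + 1) → ℂ[X]} (hdeg : ∀ i, (W i).natDegree ≤ 2)
    (hA : ∑ i : Fin (n + 1), Polynomial.X ^ (i : ℕ) * W i = 0)
    (hB : ∑ i : Fin (n + 1), Polynomial.C ((i : ℕ) : ℂ) * Polynomial.X ^ (i : ℕ) * W i = 0) :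
    W = quadSyz n fun j => (W ⟨j, by omega⟩).coeff 2 := by
  rw [← sub_eq_zero]
  refine eq_zero_of_sum_eq_zero (fun i => ?_) (fun i hi => ?_) ?_ ?_
  · exact Polynomial.natDegree_sub_le_of_le (hdeg i) (natDegree_quadSyz_le _ i)
  · rw [Pi.sub_apply, Polynomial.coeff_sub, sub_eq_zero]
    exact (coeff_two_quadSyz (fun j : Fin (n - 1) => (W ⟨j, by omega⟩).coeff 2)
      ⟨i, by omega⟩).symm
  · simp only [Pi.sub_apply, mul_sub, Finset.sum_sub_distrib, hA, sum_X_pow_mul_quadSyz, sub_zero]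
  · simp only [Pi.sub_apply, mul_sub, Finset.sum_sub_distrib, hB, sum_C_mul_X_pow_mul_quadSyz,
      sub_zero]

/-- Pairing a point with `quadSyz n h` gives a polynomial of degree at most two, whose three
coefficients are the three rows of that point applied to `h`. -/
theorem mem_ker_NMatrix {n k : ℕ} (a : Fin k → Fin (n + 1) → ℂ) (h : Fin (n - 1) → ℂ) :
    h ∈ LinearMap.ker (NMatrix a).mulVecLin ↔
      ∀ l, ∑ i, C (a l i) * quadSyz n h i = 0 := by
  have key : ∀ l, ∑ i, C (a l i) * quadSyz n h i =
      C ((NMatrix a).mulVec h (l, 0)) * X ^ 2 + C ((NMatrix a).mulVec h (l, 1)) * X +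
        C ((NMatrix a).mulVec h (l, 2)) := by
    intro l
    rw [sum_mul_quadSyz]
    simp only [Matrix.mulVec, dotProduct, map_sum, Finset.sum_mul]
    rw [← Finset.sum_add_distrib, ← Finset.sum_add_distrib]
    refine Finset.sum_congr rfl fun j _ => ?_
    simp only [NMatrix, Matrix.of_apply, Matrix.cons_val_zero, Matrix.cons_val_one,
      Matrix.cons_val_two, Matrix.tail_cons, Matrix.head_cons, C_mul, C_neg, C_ofNat]
    ring
  rw [LinearMap.mem_ker, Matrix.mulVecLin_apply]
  constructor
  · intro h0 l
    rw [key, h0]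
    simp
  · intro h0
    have h1 : ∀ l, (NMatrix a).mulVec h (l, 0) = 0 ∧ (NMatrix a).mulVec h (l, 1) = 0 ∧
        (NMatrix a).mulVec h (l, 2) = 0 := fun l => by
      have h2 := (key l).symm.trans (h0 l)
      refine ⟨?_, ?_, ?_⟩
      · simpa [coeff_X, coeff_C] using congrArg (coeff · 2) h2
      · simpa [coeff_X, coeff_C] using congrArg (coeff · 1) h2
      · simpa [coeff_X, coeff_C] using congrArg (coeff · 0) h2
    funext ⟨l, i⟩
    fin_cases i
    · exact (h1 l).1
    · exact (h1 l).2.1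
    · exact (h1 l).2.2


theorem linearMap_apply_eq_sum {l m : ℕ} (φ : (Fin l → ℂ) →ₗ[ℂ] (Fin m → ℂ)) (x : Fin l → ℂ)
    (j : Fin m) : φ x j = ∑ i, x i * φ (Pi.single i 1) j := by
  conv_lhs => rw [pi_eq_sum_univ' x]
  simp [map_sum, Finset.sum_apply]

/-! ### Projection from the centre and the rank of the matrix -/

namespace RatCurve


variable {n m : ℕ}

/-- The transpose of `π`, on polynomial vectors. -/
noncomputable def pull (π : (Fin (n + 1) → ℂ) →ₗ[ℂ] (Fin (m + 1) → ℂ)) :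
    (Fin (m + 1) → ℂ[X]) →ₗ[ℂ[X]] (Fin (n + 1) → ℂ[X]) :=
  Matrix.mulVecLin (Matrix.of fun i j => C (π (Pi.single i 1) j))

theorem pull_apply (π : (Fin (n + 1) → ℂ) →ₗ[ℂ] (Fin (m + 1) → ℂ)) (v : Fin (m + 1) → ℂ[X])
    (i : Fin (n + 1)) : pull π v i = ∑ j, C (π (Pi.single i 1) j) * v j := rfl

theorem sum_C_mul_pull (π : (Fin (n + 1) → ℂ) →ₗ[ℂ] (Fin (m + 1) → ℂ)) (v : Fin (m + 1) → ℂ[X])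
    (x : Fin (n + 1) → ℂ) : ∑ i, C (x i) * pull π v i = ∑ j, C (π x j) * v j := by
  simp only [pull_apply, Finset.mul_sum]
  rw [Finset.sum_comm]
  refine Finset.sum_congr rfl fun j _ => ?_
  rw [linearMap_apply_eq_sum π x j, map_sum, Finset.sum_mul]
  exact Finset.sum_congr rfl fun i _ => by rw [C_mul, mul_assoc]

theorem natDegree_sum_C_mul_le {ι : Type*} [Fintype ι] {v : ι → ℂ[X]} {d : ℕ} (c : ι → ℂ)
    (hv : ∀ j, (v j).natDegree ≤ d) : (∑ j, C (c j) * v j).natDegree ≤ d :=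
  natDegree_sum_le_of_forall_le _ _ fun j _ => (natDegree_C_mul_le _ _).trans (hv j)

theorem pull_injective {π : (Fin (n + 1) → ℂ) →ₗ[ℂ] (Fin (m + 1) → ℂ)}
    (hπ : Function.Surjective π) : Function.Injective (pull π) := by
  rw [injective_iff_map_eq_zero]
  intro v hv
  funext j
  obtain ⟨x, hx⟩ := hπ (Pi.single j 1)
  have h := sum_C_mul_pull π v x
  rw [hv, hx] at h
  simpa [Pi.single_apply] using h.symm

/-- A polynomial vector annihilated by the kernel of `π` comes from the target of `π`. -/
theorem exists_pull_eq {π : (Fin (n + 1) → ℂ) →ₗ[ℂ] (Fin (m + 1) → ℂ)}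
    (hπ : Function.Surjective π) {W : Fin (n + 1) → ℂ[X]} {d : ℕ}
    (hdeg : ∀ i, (W i).natDegree ≤ d)
    (hW : ∀ x ∈ LinearMap.ker π, ∑ i, C (x i) * W i = 0) :
    ∃ v : Fin (m + 1) → ℂ[X], pull π v = W ∧ ∀ j, (v j).natDegree ≤ d := by
  obtain ⟨σ, hσ⟩ := π.exists_rightInverse_of_surjective (LinearMap.range_eq_top.mpr hπ)
  have hσ' : ∀ y, π (σ y) = y := fun y => LinearMap.congr_fun hσ y
  refine ⟨fun j => ∑ i, C (σ (Pi.single j 1) i) * W i, ?_, fun j => natDegree_sum_C_mul_le _ hdeg⟩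
  funext i
  -- A basis vector differs from its image under `σ ∘ π` by an element of the kernel, so `W` is
  -- determined by its pairings with the range of `σ`.
  have h1 := hW (Pi.single i 1 - σ (π (Pi.single i 1))) (by
    rw [LinearMap.mem_ker, map_sub, hσ', sub_self])
  simp only [Pi.sub_apply, C_sub, sub_mul, Finset.sum_sub_distrib] at h1
  have h2 : ∑ i', C ((Pi.single i 1 : Fin (n + 1) → ℂ) i') * W i' = W i := by
    simp [Pi.single_apply, Finset.sum_ite_eq']
  rw [h2, sub_eq_zero] at h1
  rw [pull_apply, h1]
  simp only [Finset.mul_sum]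
  rw [Finset.sum_comm]
  refine Finset.sum_congr rfl fun i' _ => ?_
  rw [linearMap_apply_eq_sum σ _ i', map_sum, Finset.sum_mul]
  exact Finset.sum_congr rfl fun j _ => by rw [C_mul, mul_assoc]

theorem mem_syz_proj {π : (Fin (n + 1) → ℂ) →ₗ[ℂ] (Fin (m + 1) → ℂ)} {v : Fin (m + 1) → ℂ[X]} :
    v ∈ ((normalCurve n).proj π).syz ↔
      (∑ i : Fin (n + 1), C ((n - (i : ℕ) : ℕ) : ℂ) * X ^ (i : ℕ) * pull π v i = 0) ∧
        ∑ i : Fin (n + 1), C ((i : ℕ) : ℂ) * X ^ ((i : ℕ) - 1) * pull π v i = 0 := by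
  have hjac : ∀ (k : Fin 2) (D : Fin (n + 1) → ℂ[X]),
      (∀ i, MvPolynomial.aeval ![1, X]
        (MvPolynomial.pderiv k ((normalCurve n).form i)) = D i) →
      ∑ j, ((normalCurve n).proj π).jac₀ j k * v j = ∑ i, D i * pull π v i := by
    intro k D hD
    simp only [pull_apply, Finset.mul_sum]
    rw [Finset.sum_comm]
    refine Finset.sum_congr rfl fun j _ => ?_
    have : ((normalCurve n).proj π).jac₀ j k = ∑ i, C (π (Pi.single i 1) j) * D i := by
      change MvPolynomial.aeval ![1, X] (MvPolynomial.pderiv k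
        (∑ i, MvPolynomial.C (π (Pi.single i 1) j) * (normalCurve n).form i)) = _
      rw [map_sum, map_sum]
      refine Finset.sum_congr rfl fun i _ => ?_
      rw [MvPolynomial.pderiv_C_mul, map_mul, hD, MvPolynomial.aeval_C, Polynomial.algebraMap_apply,
        Algebra.algebraMap_self, RingHom.id_apply]
    rw [this, Finset.sum_mul]
    exact Finset.sum_congr rfl fun i _ => by ring
  rw [mem_syz, Fin.forall_fin_two, hjac 0 (fun i => C ((n - (i : ℕ) : ℕ) : ℂ) * X ^ (i : ℕ)),
    hjac 1 (fun i => C ((i : ℕ) : ℂ) * X ^ ((i : ℕ) - 1))]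
  · intro i
    simp [normalCurve]
  · intro i
    simp [normalCurve, mul_comm]

/-- Euler's formula replaces the two partial derivatives by the form and its derivative `z d/dz`;
recovering the form needs division by `n`. -/
theorem mem_syz_proj_iff (hn : n ≠ 0) {π : (Fin (n + 1) → ℂ) →ₗ[ℂ] (Fin (m + 1) → ℂ)}
    {v : Fin (m + 1) → ℂ[X]} :
    v ∈ ((normalCurve n).proj π).syz ↔
      (∑ i : Fin (n + 1), X ^ (i : ℕ) * pull π v i = 0) ∧
        ∑ i : Fin (n + 1), C ((i : ℕ) : ℂ) * X ^ (i : ℕ) * pull π v i = 0 := by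
  have h1 : ∑ i : Fin (n + 1), C ((i : ℕ) : ℂ) * X ^ (i : ℕ) * pull π v i =
      X * ∑ i : Fin (n + 1), C ((i : ℕ) : ℂ) * X ^ ((i : ℕ) - 1) * pull π v i := by
    rw [Finset.mul_sum]
    refine Finset.sum_congr rfl fun i _ => ?_
    rcases Nat.eq_zero_or_pos (i : ℕ) with h | h
    · simp [h]
    · obtain ⟨q, hq⟩ := Nat.exists_eq_add_of_lt h
      rw [hq]
      simp only [zero_add, Nat.add_sub_cancel, pow_succ]
      ring
  have h2 : ∑ i : Fin (n + 1), C ((n - (i : ℕ) : ℕ) : ℂ) * X ^ (i : ℕ) * pull π v i +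
      ∑ i : Fin (n + 1), C ((i : ℕ) : ℂ) * X ^ (i : ℕ) * pull π v i =
        C (n : ℂ) * ∑ i : Fin (n + 1), X ^ (i : ℕ) * pull π v i := by
    rw [← Finset.sum_add_distrib, Finset.mul_sum]
    refine Finset.sum_congr rfl fun i _ => ?_
    rw [← add_mul, ← add_mul, ← C_add, ← Nat.cast_add, Nat.sub_add_cancel (by omega), mul_assoc]
  rw [mem_syz_proj]
  have hC : (C (n : ℂ) : ℂ[X]) ≠ 0 := C_ne_zero.mpr (Nat.cast_ne_zero.mpr hn)
  constructor
  · rintro ⟨hA, hB⟩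
    rw [hB, mul_zero] at h1
    rw [hA, h1, zero_add] at h2
    exact ⟨(mul_eq_zero.mp h2.symm).resolve_left hC, h1⟩
  · rintro ⟨hA, hB⟩
    rw [hB] at h1
    rw [hA, hB, mul_zero, add_zero] at h2
    exact ⟨h2, (mul_eq_zero.mp h1.symm).resolve_left X_ne_zero⟩

/-- The syzygies of degree at most two. -/
noncomputable def quad (f : RatCurve n m) : Submodule ℂ (Fin (m + 1) → ℂ[X]) :=
  f.syz.restrictScalars ℂ ⊓ Submodule.pi Set.univ fun _ => degreeLE ℂ 2

theorem mem_quad {f : RatCurve n m} {v : Fin (m + 1) → ℂ[X]} :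
    v ∈ f.quad ↔ v ∈ f.syz ∧ ∀ j, (v j).natDegree ≤ 2 := by
  simp [quad, mem_degreeLE, natDegree_le_iff_degree_le]

/-- The transpose of `π` identifies syzygies of the projected curve with syzygies of `C_n` that
annihilate the centre. Its matrix is constant, so degree bounds are preserved. -/
theorem map_quad {k : ℕ} (hn : n ≠ 0) {a : Fin k → Fin (n + 1) → ℂ}
    {π : (Fin (n + 1) → ℂ) →ₗ[ℂ] (Fin (m + 1) → ℂ)} (hπ : Function.Surjective π)
    (hker : LinearMap.ker π = Submodule.span ℂ (Set.range a)) :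
    ((normalCurve n).proj π).quad.map ((pull π).restrictScalars ℂ) =
      (LinearMap.ker (NMatrix a).mulVecLin).map (quadSyz n) := by
  ext W
  simp only [Submodule.mem_map, LinearMap.coe_restrictScalars]
  constructor
  · rintro ⟨v, hv, rfl⟩
    obtain ⟨hs, hdeg⟩ := mem_quad.mp hv
    obtain ⟨hA, hB⟩ := (mem_syz_proj_iff hn).mp hs
    have hW := eq_quadSyz (W := pull π v) (fun i => natDegree_sum_C_mul_le _ hdeg) hA hB
    refine ⟨_, (mem_ker_NMatrix a _).mpr fun l => ?_, hW.symm⟩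
    have hl : π (a l) = 0 := by
      rw [← LinearMap.mem_ker, hker]
      exact Submodule.subset_span ⟨l, rfl⟩
    rw [← hW, sum_C_mul_pull, hl]
    simp
  · rintro ⟨h, hh, rfl⟩
    rw [mem_ker_NMatrix] at hh
    obtain ⟨v, hv, hdeg⟩ := exists_pull_eq hπ (natDegree_quadSyz_le h) (by
      intro x hx
      rw [hker] at hx
      induction hx using Submodule.span_induction with
      | mem x hx => obtain ⟨l, rfl⟩ := hx; exact hh l
      | zero => simp
      | add x y _ _ hx hy =>
        simp only [Pi.add_apply, C_add, add_mul, Finset.sum_add_distrib, hx, hy, add_zero]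
      | smul c x _ hx =>
        simp only [Pi.smul_apply, smul_eq_mul, C_mul, mul_assoc, ← Finset.mul_sum, hx, mul_zero])
    refine ⟨v, mem_quad.mpr ⟨(mem_syz_proj_iff hn).mpr ?_, hdeg⟩, hv⟩
    rw [hv]
    exact ⟨sum_X_pow_mul_quadSyz h, sum_C_mul_X_pow_mul_quadSyz h⟩

theorem finrank_quad_add_rank {k : ℕ} (hn : n ≠ 0) {a : Fin k → Fin (n + 1) → ℂ}
    {π : (Fin (n + 1) → ℂ) →ₗ[ℂ] (Fin (m + 1) → ℂ)} (hπ : Function.Surjective π)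
    (hker : LinearMap.ker π = Submodule.span ℂ (Set.range a)) :
    Module.finrank ℂ ((normalCurve n).proj π).quad + (NMatrix a).rank = n - 1 := by
  have h1 : Module.finrank ℂ ((normalCurve n).proj π).quad =
      Module.finrank ℂ (LinearMap.ker (NMatrix a).mulVecLin) := by
    rw [(Submodule.equivMapOfInjective ((pull π).restrictScalars ℂ) (pull_injective hπ)
      ((normalCurve n).proj π).quad).finrank_eq, map_quad hn hπ hker,
      ← (Submodule.equivMapOfInjective (quadSyz n) (quadSyz_injective n) _).finrank_eq]
  have h2 := LinearMap.finrank_range_add_finrank_ker (NMatrix a).mulVecLin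
  rw [Module.finrank_fintype_fun_eq_card, Fintype.card_fin] at h2
  rw [h1, Matrix.rank]
  omega

theorem eq_zero_of_mem_syz_of_natDegree_le_one (hn : n ≠ 0)
    {π : (Fin (n + 1) → ℂ) →ₗ[ℂ] (Fin (m + 1) → ℂ)}
    (hπ : Function.Surjective π) {v : Fin (m + 1) → ℂ[X]}
    (hv : v ∈ ((normalCurve n).proj π).syz) (hdeg : ∀ j, (v j).natDegree ≤ 1) : v = 0 := by
  obtain ⟨hA, hB⟩ := (mem_syz_proj_iff hn).mp hv
  have h1 : ∀ i, (pull π v i).natDegree ≤ 1 := fun i => natDegree_sum_C_mul_le _ hdeg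
  refine pull_injective hπ (Eq.trans ?_ (map_zero _).symm)
  exact eq_zero_of_sum_eq_zero (fun i => (h1 i).trans one_le_two)
    (fun i _ => coeff_eq_zero_of_natDegree_lt (lt_of_le_of_lt (h1 i) one_lt_two)) hA hB

/-- Since no row has degree bound below two, the rows of bound exactly two form a basis of the
quadratic syzygies, whose dimension is `n - 1 - ρ`. -/
theorem exists_normalBundle_isomorphic {k : ℕ} (hkn : k + 3 ≤ n)
    {a : Fin k → Fin (n + 1) → ℂ} {π : (Fin (n + 1) → ℂ) →ₗ[ℂ] (Fin (n - k + 1) → ℂ)}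
    (hπ : Function.Surjective π) (hker : LinearMap.ker π = Submodule.span ℂ (Set.range a))
    (himm : ((normalCurve n).proj π).IsImmersion) :
    ∃ (r : ℕ) (b : Fin r → ℕ), r + k + 1 = n ∧ (∀ i, 2 ≤ b i) ∧ ∑ i, b i = 2 * (n - 1) ∧
      Fintype.card {i // b i = 2} + (NMatrix a).rank = n - 1 ∧
      ((normalCurve n).proj π).normalBundle.Isomorphic (QCoh.lineSum fun i => (n : ℤ) + b i) := by
  have hn : n ≠ 0 := by omega
  obtain ⟨p, b, hp⟩ := exists_isMinimalBasis ((normalCurve n).proj π).syz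
  have hr := himm.finrank_syz
  obtain ⟨hiso, hsum⟩ := himm.normalBundle_isomorphic hp hr
  have hb : ∀ i, 2 ≤ b i := by
    intro i
    by_contra hlt
    exact hp.linearIndependent.ne_zero i (eq_zero_of_mem_syz_of_natDegree_le_one hn hπ (hp.mem i)
      fun j => (hp.natDegree_le i j).trans (by omega))
  refine ⟨_, b, by omega, hb, hsum, ?_, hiso⟩
  rw [← hp.finrank_eq_card hb (D := ((normalCurve n).proj π).quad) fun v => mem_quad]
  exact finrank_quad_add_rank hn hπ hker

end RatCurve


/-! ### Splitting off equal summands -/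

namespace QCoh

theorem isomorphic_dsum_assoc (M N Q : QCoh) :
    Isomorphic ((M.dsum N).dsum Q) (M.dsum (N.dsum Q)) :=
  ⟨⟨LinearEquiv.prodAssoc _ _ _ _, LinearEquiv.prodAssoc _ _ _ _, LinearEquiv.prodAssoc _ _ _ _,
    fun _ => rfl, fun _ => rfl⟩⟩

/-- Splitting off `O(c)^p` from a sum of line bundles. -/
theorem exists_isomorphic_O_dsum {ι : Type} [Fintype ι] (d : ι → ℤ) (c : ℤ) {p m : ℕ}
    (hp : p ≤ Fintype.card {i // d i = c}) (hpm : p + m = Fintype.card ι) :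
    ∃ l : Fin m → ℤ, Isomorphic (lineSum d) ((O c p).dsum (lineSum l)) ∧
      (∀ i, ∃ j, l i = d j) ∧ ∀ φ : ℤ → ℤ, ∑ i, φ (d i) = p * φ c + ∑ i, φ (l i) := by
  classical
  obtain ⟨g⟩ : Nonempty (Fin p ↪ {i // d i = c}) :=
    Function.Embedding.nonempty_of_card_le (by simpa using hp)
  let g' : Fin p ↪ ι := g.trans (Function.Embedding.subtype _)
  have hcard : Fintype.card ((Set.range g')ᶜ : Set ι) = Fintype.card (Fin m) := by
    have h1 : Fintype.card (Set.range g') = p := by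
      rw [Set.card_range_of_injective g'.injective, Fintype.card_fin]
    have h2 := Fintype.card_compl_set (Set.range g')
    rw [h2, h1, Fintype.card_fin]
    omega
  let e₂ := Fintype.equivOfCardEq hcard
  let e : Fin p ⊕ Fin m ≃ ι := ((Equiv.ofInjective g' g'.injective).sumCongr e₂.symm).trans
    (Equiv.Set.sumCompl (Set.range g'))
  have hl : ∀ i, d (e (Sum.inl i)) = c := fun i => (g i).2
  have he : d ∘ e = Sum.elim (fun _ => c) (fun i => d (e (Sum.inr i))) := by
    funext x
    rcases x with i | i
    · exact hl i
    · rfl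
  refine ⟨fun i => d (e (Sum.inr i)), ?_, fun i => ⟨_, rfl⟩, fun φ => ?_⟩
  · refine (isomorphic_lineSum_comp d e).symm.trans ?_
    rw [he]
    exact (isomorphic_dsum_lineSum _ _).symm
  · rw [← e.sum_comp, Fintype.sum_sum_type]
    simp [hl]

theorem card_le_eq_sum {ι : Type} [Fintype ι] (d : ι → ℤ) (c : ℤ) :
    (Fintype.card {i // d i ≤ c} : ℤ) = ∑ i, if d i ≤ c then 1 else 0 := by
  rw [Fintype.card_subtype, Finset.sum_boole]

end QCoh

end P1
-- The splitting type in terms of the rank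
theorem mainTheorem9 (n k : ℕ) (hk : 1 ≤ k) (hkn : k + 3 ≤ n)
    (a : Fin k → Fin (n + 1) → ℂ) (ha : LinearIndependent ℂ a)
    (π : (Fin (n + 1) → ℂ) →ₗ[ℂ] (Fin (n - k + 1) → ℂ)) (hπ : Function.Surjective π)
    (hker : LinearMap.ker π = Submodule.span ℂ (Set.range a))
    (himm : ((P1.RatCurve.normalCurve n).proj π).IsImmersion) :
    -- the splitting in terms of the rank
    (k ≤ (P1.NMatrix a).rank ∧ (P1.NMatrix a).rank ≤ n - 1 ∧
      ∃ l : Fin ((P1.NMatrix a).rank - k) → ℤ,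
        (∀ i, (n : ℤ) + 3 ≤ l i) ∧
        ∑ i, ((n : ℤ) + 2 - l i) = -2 * k ∧
        ((P1.RatCurve.normalCurve n).proj π).normalBundle.Isomorphic
          ((P1.QCoh.O (n + 2) (n - 1 - (P1.NMatrix a).rank)).dsum (P1.QCoh.lineSum l))) ∧
    -- the first case
    (∀ r : ℕ, 1 ≤ r → r + k + 2 ≤ n →
      ((∃ q m : ℕ, (q : ℤ) = 2 * ((n : ℤ) - k - r) - 2 * k ∧
          (m : ℤ) = (n : ℤ) - r - 2 * ((n : ℤ) - k - r) + k ∧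
          ∃ l : Fin m → ℤ,
            (∀ i, (n : ℤ) + 3 ≤ l i) ∧
            ∑ i, ((n : ℤ) + 2 - l i) = -2 * k + (2 * ((n : ℤ) - k - r) - 2 * k) ∧
            ((P1.RatCurve.normalCurve n).proj π).normalBundle.Isomorphic
              (((P1.QCoh.O (n + 2) (r - 1)).dsum (P1.QCoh.O (n + 3) q)).dsum
                (P1.QCoh.lineSum l))) ↔
        (P1.NMatrix a).rank = n - r ∧ 2 * k ≤ 2 * (n - k - r))) ∧
    -- the second case
    (((P1.RatCurve.normalCurve n).proj π).normalBundle.Isomorphic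
        ((P1.QCoh.O (n + 2) (n - k - 2)).dsum (P1.QCoh.O (n + 2 + 2 * k) 1)) ↔
      (P1.NMatrix a).rank = k + 1) := by
  classical
  obtain ⟨r₀, b, hr₀, hb, hsum, hcount, hiso⟩ :=
    P1.RatCurve.exists_normalBundle_isomorphic hkn hπ hker himm
  set N := ((P1.RatCurve.normalCurve n).proj π).normalBundle with hN
  set ρ := (P1.NMatrix a).rank with hρ
  have hcount' : Fintype.card {i // (n : ℤ) + b i = n + 2} = n - 1 - ρ := by
    rw [show Fintype.card {i // (n : ℤ) + b i = n + 2} = Fintype.card {i // b i = 2} from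
      Fintype.card_congr (Equiv.subtypeEquivRight fun i => by omega)]
    omega
  have hle : Fintype.card {i // b i = 2} ≤ r₀ := by
    simpa using Fintype.card_subtype_le fun i => b i = 2
  have hkρ : k ≤ ρ := by omega
  have hρn : ρ ≤ n - 1 := by omega
  obtain ⟨l, hl, hld, hlφ⟩ := P1.QCoh.exists_isomorphic_O_dsum (fun i => (n : ℤ) + b i)
    (n + 2) (p := n - 1 - ρ) (m := ρ - k) hcount'.ge (by rw [Fintype.card_fin]; omega)
  have hl2 : ∀ i, (n : ℤ) + 2 ≤ l i := fun i => by
    obtain ⟨j, hj⟩ := hld i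
    have := hb j
    omega
  have hl3 : ∀ i, (n : ℤ) + 3 ≤ l i := by
    -- The indicator function shows that all summands `O(n + 2)` have been split off, so none is
    -- left among the `l i`.
    have h1 := hlφ fun x => if x = n + 2 then 1 else 0
    have h2 : ∑ i, (if (n : ℤ) + b i = n + 2 then (1 : ℤ) else 0) = (n - 1 - ρ : ℕ) := by
      rw [← hcount', Fintype.card_subtype, Finset.sum_boole]
    rw [h2, if_pos rfl, mul_one, left_eq_add, Finset.sum_eq_zero_iff_of_nonneg
      (fun i _ => by split_ifs <;> norm_num)] at h1
    intro i
    have h3 := h1 i (Finset.mem_univ i)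
    have h4 := hl2 i
    split_ifs at h3 <;> omega
  have hlsum : ∑ i, ((n : ℤ) + 2 - l i) = -2 * k := by
    have h1 := hlφ fun x => n + 2 - x
    rw [sub_self, mul_zero, zero_add] at h1
    rw [← h1]
    have h2 : ∑ i, ((n : ℤ) + 2 - (n + b i)) = r₀ * 2 - ((∑ i, b i : ℕ) : ℤ) := by
      push_cast
      simp only [add_sub_add_left_eq_sub, Finset.sum_sub_distrib, Finset.sum_const,
        Finset.card_univ, Fintype.card_fin, nsmul_eq_mul]
    rw [h2, hsum]
    push_cast [show 1 ≤ n by omega]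
    omega
  have hNl := hiso.trans hl
  -- Any splitting of `N` has the same number of summands of degree at most `n + 2`; as every `b i ≥
  -- 2`, this number is `n - 1 - ρ`.
  have hcard : ∀ {ι : Type} [Fintype ι] (d : ι → ℤ), N.Isomorphic (P1.QCoh.lineSum d) →
      ∑ i, (if d i ≤ (n : ℤ) + 2 then (1 : ℤ) else 0) = (n - 1 - ρ : ℕ) := by
    intro ι _ d hd
    rw [← P1.QCoh.card_le_eq_sum, ← (hiso.symm.trans hd).card_eq (n + 2), ← hcount']
    exact congrArg _ (Fintype.card_congr (Equiv.subtypeEquivRight fun i => by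
      have := hb i
      omega))
  refine ⟨⟨hkρ, hρn, l, hl3, hlsum, hNl⟩, fun r hr1 hrk => ⟨?_, ?_⟩, ⟨fun h => ?_, fun h => ?_⟩⟩
  · rintro ⟨q, m, hq, -, l', hl', -, h⟩
    have h1 := hcard _ ((h.trans ((P1.QCoh.isomorphic_dsum_lineSum _ _).dsum
      (P1.QCoh.isomorphic_refl _))).trans (P1.QCoh.isomorphic_dsum_lineSum _ _))
    have h2 : ∀ i, ¬ l' i ≤ (n : ℤ) + 2 := fun i => by have := hl' i; omega
    have h3 : ¬ (n : ℤ) + 3 ≤ n + 2 := by omega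
    simp only [Fintype.sum_sum_type, Sum.elim_inl, Sum.elim_inr, le_refl, if_true, h2, h3,
      if_false, Finset.sum_const, Finset.card_univ, Fintype.card_fin, nsmul_eq_mul, mul_one,
      mul_zero, add_zero] at h1
    have h4 : r - 1 = n - 1 - ρ := by exact_mod_cast h1
    omega
  · rintro ⟨h1, h2⟩
    have hsum' : ∑ i, (l i - ((n : ℤ) + 3)) = 2 * k - (n - r - k : ℕ) := by
      have h3 : ∀ i, l i - ((n : ℤ) + 3) = -((n : ℤ) + 2 - l i) - 1 := fun i => by ring
      simp only [h3, Finset.sum_sub_distrib, Finset.sum_neg_distrib, hlsum, Finset.sum_const,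
        Finset.card_univ, Fintype.card_fin, nsmul_eq_mul, mul_one, h1]
      ring
    have hnn : (0 : ℤ) ≤ ∑ i, (l i - ((n : ℤ) + 3)) :=
      Finset.sum_nonneg fun i _ => by have := hl3 i; omega
    -- Each of the `n - r - k` summands either has degree `n + 3` or adds at least one to the total
    -- excess `2k - (n - r - k)`. Hence at least `2(n - k - r) - 2k` of them have degree `n + 3`.
    have hcnt : ((n - r - k : ℕ) : ℤ) ≤
        Fintype.card {i // l i = (n : ℤ) + 3} + ∑ i, (l i - ((n : ℤ) + 3)) := by
      rw [Fintype.card_subtype, ← Finset.sum_boole (R := ℤ), ← Finset.sum_add_distrib]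
      calc ((n - r - k : ℕ) : ℤ) = ∑ _i : Fin (ρ - k), (1 : ℤ) := by simp [h1]
        _ ≤ _ := Finset.sum_le_sum fun i _ => by
          have := hl3 i
          split_ifs <;> omega
    obtain ⟨l', h4, h5, h6⟩ := P1.QCoh.exists_isomorphic_O_dsum l (n + 3)
      (p := 2 * (n - k - r) - 2 * k) (m := (n - r + k) - 2 * (n - k - r)) (by omega)
      (by rw [Fintype.card_fin]; omega)
    refine ⟨2 * (n - k - r) - 2 * k, (n - r + k) - 2 * (n - k - r), by omega, by omega, l',
      fun i => ?_, ?_, ?_⟩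
    · obtain ⟨j, hj⟩ := h5 i
      rw [hj]
      exact hl3 j
    · have h7 := h6 fun x => n + 2 - x
      rw [hlsum] at h7
      have h8 : ((2 * (n - k - r) - 2 * k : ℕ) : ℤ) = 2 * ((n : ℤ) - k - r) - 2 * k := by omega
      rw [h8] at h7
      linear_combination -h7
    · have h7 : r - 1 = n - 1 - ρ := by omega
      rw [h7]
      exact (hNl.trans ((P1.QCoh.isomorphic_refl _).dsum h4)).trans
        (P1.QCoh.isomorphic_dsum_assoc _ _ _).symm
  · have h1 := hcard _ (h.trans (P1.QCoh.isomorphic_dsum_lineSum _ _))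
    have h3 : ¬ (n : ℤ) + 2 + 2 * k ≤ n + 2 := by omega
    simp only [Fintype.sum_sum_type, Sum.elim_inl, Sum.elim_inr, le_refl, if_true, h3,
      if_false, Finset.sum_const, Finset.card_univ, Fintype.card_fin, nsmul_eq_mul, mul_one] at h1
    have h4 : n - k - 2 = n - 1 - ρ := by exact_mod_cast h1
    omega
  -- Only one summand is left, and the degree sum makes it `O(n + 2 + 2k)`.
  · have h1 : 1 = ρ - k := by omega
    have h2 : l ∘ finCongr h1 = fun _ => (n : ℤ) + 2 + 2 * k := by
      have h3 := (finCongr h1).sum_comp fun i => (n : ℤ) + 2 - l i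
      rw [hlsum, Fin.sum_univ_one] at h3
      funext i
      rw [Subsingleton.elim i 0, Function.comp_apply]
      linarith
    have h3 := P1.QCoh.isomorphic_lineSum_comp l (finCongr h1)
    rw [h2] at h3
    rw [show n - k - 2 = n - 1 - ρ by omega]
    exact hNl.trans ((P1.QCoh.isomorphic_refl _).dsum h3.symm)
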